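/- Let $X_1,X_2,\dots$ be independent real random variables with a common continuous (i.e. atomless) distribution, let $S_0=0$ and $S_j=\sum_{i=1}^j X_i$. Let $0\le q<1$ and let $n(q)$ be a random variable with values in $\{0,1,2,\dots\}$, independent of $(X_i)_{i\ge1}$, with $P(n(q)\ge n)=q^n$ for $n=0,1,2,\dots$. Consider the walk $S^{[0,n(q)]}=\{(j,S_j):0\le j\le n(q)\}$ and its concave majorant, i.e. the least concave function $C$ on $[0,n(q)]$ with $C(j)\ge S_j$ for all integers $0\le j\le n(q)$. Let $T_0<T_1<\dots<T_F$ be the successive times $j\in\{0,\dots,n(q)\}$ with $C(j)=S_j$, so that $T_0=0$ and $T_F=n(q)$. For $0\le i<F$ the chord of the concave majorant from $(T_i,S_{T_i})$ to $(T_{i+1},S_{T_{i+1}})$ is called a face, with length $T_{i+1}-T_i$ and increment $S_{T_{i+1}}-S_{T_i}$. (1) The point process on $\{1,2,\dots\}\times\mathbb{R}$ of the lengths and increments of the faces is a Poisson point process with intensity measure $j^{-1}q^j\,P(S_j\in dx)$, $j=1,2,\dots$, $x\in\mathbb{R}$. (2) The path segments $$(S_{T_i+k}-S_{T_i},\ 1\le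 k\le T_{i+1}-T_i),\qquad i=0,\dots,F-1,$$ are the points of a Poisson point process in the space $\bigcup_{j\ge1}\mathbb{R}^j$ of finite walk segments $(s_1,\dots,s_j)$, $j=1,2,\dots$, whose intensity measure on segments of length $j$ is $q^j j^{-1}$ times the conditional distribution of $(S_1,\dots,S_j)$ given that $S_k<(k/j)S_j$ for all $1\le k\le j-1$. -/

import Mathlib

open MeasureTheory ProbabilityTheory

/-- The discrete σ-algebra on `{1, 2, …}`. -/
instance instMeasurableSpacePNatDiscrete : MeasurableSpace ℕ+ := ⊤

instance instDiscreteMeasurableSpacePNat : DiscreteMeasurableSpace ℕ+ := ⟨fun _ => trivial⟩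

/-! ### Poisson point processes -/

section PoissonPointProcess

variable {Ω E : Type*} [MeasurableSpace Ω] [MeasurableSpace E]

/-- `ξ` is a Poisson point process on `E` with intensity measure `ν`, under the law `P`: a random
integer-valued measure such that the number of points in a measurable set `B` is Poisson distributed
with mean `ν B` (it is almost surely infinite if `ν B = ∞`), and such that the numbers of points in
finitely many pairwise disjoint measurable sets are independent. -/
structure IsPoissonPointProcess (P : Measure Ω) (ξ : Ω → Measure E) (ν : Measure E) : Prop where
  measurable : Measurable ξ
  integer_valued : ∀ ω, ∀ B, MeasurableSet B → ∃ k : ℕ∞, ξ ω B = (k : ENNReal)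
  poisson : ∀ B, MeasurableSet B → ν B ≠ ⊤ →
    P.map (fun ω => ξ ω B) =
      (poissonMeasure (ν B).toNNReal).map (fun k : ℕ => (k : ENNReal))
  infinite : ∀ B, MeasurableSet B → ν B = ⊤ → ∀ᵐ ω ∂P, ξ ω B = ⊤
  indep : ∀ (m : ℕ) (B : Fin m → Set E), (∀ i, MeasurableSet (B i)) →
    Pairwise (fun i j => Disjoint (B i) (B j)) →
    iIndepFun (fun i ω => ξ ω (B i)) P

end PoissonPointProcess

noncomputable section ConcaveMajorant

/-! ### The concave majorant of a path and its faces

A path is a function `s : ℕ → ℝ`; its restriction to `{0, …, n}` is considered. -/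

/-- The values at `t` of the concave functions on `[0, n]` that dominate the path at
`0, 1, …, n`. -/
def majorantValues (s : ℕ → ℝ) (n : ℕ) (t : ℝ) : Set ℝ :=
  {y | ∃ C : ℝ → ℝ, ConcaveOn ℝ (Set.Icc 0 (n : ℝ)) C ∧ (∀ j : ℕ, j ≤ n → s j ≤ C j) ∧ C t = y}

/-- The concave majorant on `[0, n]`: the least concave function on `[0, n]` that dominates
the path at `0, 1, …, n` (see `concaveMajorant_spec`). -/
def concaveMajorant (s : ℕ → ℝ) (n : ℕ) (t : ℝ) : ℝ :=
  sInf (majorantValues s n t)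

lemma majorantValues_nonempty (s : ℕ → ℝ) (n : ℕ) (t : ℝ) : (majorantValues s n t).Nonempty := by
  refine ⟨∑ i ∈ Finset.range (n + 1), |s i|, fun _ => ∑ i ∈ Finset.range (n + 1), |s i|,
    concaveOn_const _ (convex_Icc _ _), fun j hj => ?_, rfl⟩
  exact (le_abs_self _).trans (Finset.single_le_sum (f := fun i => |s i|)
    (fun i _ => abs_nonneg _) (Finset.mem_range.2 (by omega)))

lemma majorantValues_bddBelow (s : ℕ → ℝ) (n : ℕ) {t : ℝ} (ht : t ∈ Set.Icc 0 (n : ℝ)) :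
    BddBelow (majorantValues s n t) := by
  refine ⟨min (s 0) (s n), ?_⟩
  rintro y ⟨C, hC, hs, rfl⟩
  have h0 : (0 : ℝ) ∈ Set.Icc 0 (n : ℝ) := ⟨le_rfl, Nat.cast_nonneg n⟩
  have hn : (n : ℝ) ∈ Set.Icc 0 (n : ℝ) := ⟨Nat.cast_nonneg n, le_rfl⟩
  have h := hC.min_le_of_mem_Icc h0 hn ht
  have h1 := hs 0 (Nat.zero_le n)
  have h2 := hs n le_rfl
  rw [Nat.cast_zero] at h1
  exact (min_le_min h1 h2).trans h

theorem concaveMajorant_spec (s : ℕ → ℝ) (n : ℕ) :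
    ConcaveOn ℝ (Set.Icc 0 (n : ℝ)) (concaveMajorant s n) ∧
    (∀ j : ℕ, j ≤ n → s j ≤ concaveMajorant s n j) ∧
    ∀ C : ℝ → ℝ, ConcaveOn ℝ (Set.Icc 0 (n : ℝ)) C → (∀ j : ℕ, j ≤ n → s j ≤ C j) →
      ∀ t ∈ Set.Icc 0 (n : ℝ), concaveMajorant s n t ≤ C t := by
  have key : ∀ C : ℝ → ℝ, ConcaveOn ℝ (Set.Icc 0 (n : ℝ)) C → (∀ j : ℕ, j ≤ n → s j ≤ C j) →
      ∀ t ∈ Set.Icc 0 (n : ℝ), concaveMajorant s n t ≤ C t := fun C hC hs t ht =>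
    csInf_le (majorantValues_bddBelow s n ht) ⟨C, hC, hs, rfl⟩
  refine ⟨⟨convex_Icc _ _, ?_⟩, ?_, key⟩
  · intro x hx y hy a b ha hb hab
    refine le_csInf (majorantValues_nonempty _ _ _) ?_
    rintro z ⟨C, hC, hs, rfl⟩
    refine le_trans ?_ (hC.2 hx hy ha hb hab)
    have h1 := key C hC hs x hx
    have h2 := key C hC hs y hy
    simp only [smul_eq_mul]
    gcongr
  · intro j hj
    refine le_csInf (majorantValues_nonempty _ _ _) ?_
    rintro z ⟨C, hC, hs, rfl⟩
    exact hs j hj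

/-- The times `j ∈ {0, …, n}` at which the path meets its concave majorant on `[0, n]`. -/
def meetSet (s : ℕ → ℝ) (n : ℕ) : Set ℕ :=
  {j | j ≤ n ∧ s j = concaveMajorant s n j}

/-- `T_i`, the `i`-th time (counted from `0`, in increasing order) at which the path meets its
concave majorant on `[0, n]`, for `0 ≤ i ≤ numFaces s n`. -/
def meetTime (s : ℕ → ℝ) (n i : ℕ) : ℕ :=
  Nat.nth (fun j => j ∈ meetSet s n) i

/-- The number of faces of the concave majorant on `[0, n]`. -/
def numFaces (s : ℕ → ℝ) (n : ℕ) : ℕ :=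
  (meetSet s n).ncard - 1

/-- The length `T_{i+1} - T_i` of the face from `T_i` to `T_{i+1}`, for `i < numFaces s n`, as a
positive integer (see `coe_faceLength`). -/
def faceLength (s : ℕ → ℝ) (n i : ℕ) : ℕ+ :=
  (meetTime s n (i + 1) - meetTime s n i).toPNat'

/-- The increment of the path over the face from `T_i` to `T_{i+1}`. -/
def faceIncrement (s : ℕ → ℝ) (n i : ℕ) : ℝ :=
  s (meetTime s n (i + 1)) - s (meetTime s n i)

lemma meetSet_finite (s : ℕ → ℝ) (n : ℕ) : (meetSet s n).Finite :=
  (Set.finite_Iic n).subset fun _ hj => hj.1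

lemma meetTime_lt_meetTime_succ (s : ℕ → ℝ) (n i : ℕ) (hi : i < numFaces s n) :
    meetTime s n i < meetTime s n (i + 1) := by
  unfold numFaces at hi
  have hf : {j | j ∈ meetSet s n}.Finite := meetSet_finite s n
  refine Nat.nth_lt_nth_of_lt_card hf (Nat.lt_succ_self i) ?_
  rw [← Set.ncard_eq_toFinset_card _ hf]
  change i + 1 < (meetSet s n).ncard
  omega

lemma coe_faceLength (s : ℕ → ℝ) (n i : ℕ) (hi : i < numFaces s n) :
    (faceLength s n i : ℕ) = meetTime s n (i + 1) - meetTime s n i := by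
  have h := meetTime_lt_meetTime_succ s n i hi
  simp only [faceLength, Nat.toPNat'_coe]
  rw [if_pos (by omega)]

/-- The space of finite walk segments `(s_1, …, s_j)`, `j = 1, 2, …`, with the disjoint union of
the Borel σ-algebras of the spaces `ℝ^j`. -/
abbrev PathSegment : Type := Σ j : ℕ+, (Fin (j : ℕ) → ℝ)

/-- The initial segment `(s_1, …, s_j)` of a path (which starts at `s_0 = 0`). -/
def initialSegment (s : ℕ → ℝ) (j : ℕ+) : PathSegment :=
  ⟨j, fun k => s ((k : ℕ) + 1)⟩

/-- The segment `(s_{T_i + k} - s_{T_i})_{1 ≤ k ≤ T_{i+1} - T_i}` of the path below the face from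
`T_i` to `T_{i+1}` (the value `0` at `k = 0` is omitted). -/
def faceSegment (s : ℕ → ℝ) (n i : ℕ) : PathSegment :=
  initialSegment (fun k => s (meetTime s n i + k) - s (meetTime s n i)) (faceLength s n i)

/-- The point process of lengths and increments of the faces, as a counting measure. -/
def faceProcess (s : ℕ → ℝ) (n : ℕ) : Measure (ℕ+ × ℝ) :=
  ∑ i ∈ Finset.range (numFaces s n), Measure.dirac (faceLength s n i, faceIncrement s n i)

/-- The point process of path segments below the faces, as a counting measure. -/
def segmentProcess (s : ℕ → ℝ) (n : ℕ) : Measure PathSegment :=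
  ∑ i ∈ Finset.range (numFaces s n), Measure.dirac (faceSegment s n i)

end ConcaveMajorant

noncomputable section Intensities

variable {Ω : Type*} [MeasurableSpace Ω]

/-- The random walk `S_j = X_1 + ⋯ + X_j`, as a path for each `ω`; the increment `X_{i+1}` of the
mathematical text is `X i` here. -/
def walk (X : ℕ → Ω → ℝ) (ω : Ω) (j : ℕ) : ℝ :=
  ∑ i ∈ Finset.range j, X i ω

/-- The measure `j⁻¹ q^j P(S_j ∈ dx)` on `{1, 2, …} × ℝ`. -/
def faceIntensity (P : Measure Ω) (X : ℕ → Ω → ℝ) (q : ℝ) : Measure (ℕ+ × ℝ) :=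
  Measure.sum fun j : ℕ+ =>
    ENNReal.ofReal (q ^ (j : ℕ) / (j : ℕ)) • P.map (fun ω => (j, walk X ω j))

/-- The event that `S_k < (k / j) S_j` for all `1 ≤ k ≤ j - 1`. -/
def belowChord (X : ℕ → Ω → ℝ) (j : ℕ) : Set Ω :=
  {ω | ∀ k : ℕ, 1 ≤ k → k < j → walk X ω k < (k : ℝ) / (j : ℝ) * walk X ω j}

/-- The measure on path segments which, on segments of length `j`, is `q^j j⁻¹` times the
conditional distribution of `(S_1, …, S_j)` given that `S_k < (k / j) S_j` for all
`1 ≤ k ≤ j - 1`. -/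
def segmentIntensity (P : Measure Ω) (X : ℕ → Ω → ℝ) (q : ℝ) : Measure PathSegment :=
  Measure.sum fun j : ℕ+ =>
    ENNReal.ofReal (q ^ (j : ℕ) / (j : ℕ)) •
      (ProbabilityTheory.cond P (belowChord X j)).map (fun ω => initialSegment (walk X ω) j)

end Intensities

/-! The law of a finite point process is read off from the expectations of the products of `g` over
its points, so the goal is E ∏ g = exp (∫ (g - 1) dν) for a suitable intensity ν on path segments.

The first face ends at the least time l that maximises S_l / l. Before l the walk is strictly below
its chord, and after l it never exceeds the line of slope S_l / l. The steps after l are independent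
of the past, and the remaining faces are those of the restarted walk, all of slope at most S_l / l.
Weight a walk of length n by q^n and let H_f(a) be the total weight of ∏ g over walks with f faces,
all of slope at most a. With ν = ∑ q^l P(walk below its chord up to l, initial segment ∈ ·), this
gives H_{f+1}(a) = ∫ H_f(slope z) g(z) ν(dz) over segments z of slope at most a (`faceGenFun_succ`).
The common step law has no atoms, so slopes have no atoms under g ν, and integrating over the f!
orderings of f slopes gives H_f(∞) = (∫ g dν)^f / f! (`iterated_lintegral_eq`). Summing over f, with
the factor 1 - q of the geometric law, yields (1 - q) exp (∫ g dν). The case g = 1 identifies 1 - q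
as exp (-ν(total)), so the process is Poisson (`isPoissonPointProcess_of_lintegral_prod`).

It remains to recognise ν. Almost surely exactly one of the l cyclic rotations of the first l steps
puts the walk below its chord, and rotations preserve S_l. Hence being below the chord has
probability 1/l and is independent of S_l (`cycle_lemma`). This turns ν into q^l / l times the
conditional law, and its image under (length, increment) into q^l / l times the law of S_l. The
statement for lengths and increments is therefore an image of the one for segments. -/

open scoped ENNReal

/-! ### Poisson processes from their multiplicative functionals -/

section PoissonCharacterization

/-- Two probability measures on `ℝ^ι` with the same everywhere finite moment generating function
are equal. -/
theorem ext_of_mgf_pi {ι : Type*} [Fintype ι] {μ ν : Measure (ι → ℝ)}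
    [IsProbabilityMeasure μ] [IsProbabilityMeasure ν]
    (hint : ∀ t : ι → ℝ, Integrable (fun x => Real.exp (∑ i, t i * x i)) μ)
    (h : ∀ t : ι → ℝ, ∫ x, Real.exp (∑ i, t i * x i) ∂μ = ∫ x, Real.exp (∑ i, t i * x i) ∂ν) :
    μ = ν := by
  classical
  refine Measure.ext_of_charFunDual (funext fun L => ?_)
  obtain ⟨a, hL⟩ : ∃ a : ι → ℝ, ∀ x : ι → ℝ, L x = ∑ i, a i * x i := by
    refine ⟨fun i => L (Pi.single i 1), fun x => ?_⟩
    conv_lhs => rw [← Finset.univ_sum_single x, map_sum]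
    refine Finset.sum_congr rfl fun i _ => ?_
    have : (Pi.single i (x i) : ι → ℝ) = x i • Pi.single i (1 : ℝ) := by
      rw [← Pi.single_smul]; simp
    rw [this, map_smul, smul_eq_mul, mul_comm]
  have hs : ∀ (s : ℝ) (x : ι → ℝ), s * L x = ∑ i, (s * a i) * x i := fun s x => by
    rw [hL, Finset.mul_sum]
    simp only [mul_assoc]
  have h1 : mgf L μ = mgf L ν := by
    ext s
    simp only [mgf, hs]
    exact h _
  have h2 : integrableExpSet L μ = Set.univ := by
    refine Set.eq_univ_of_forall fun s => ?_
    simp only [integrableExpSet, Set.mem_ofPred_eq, hs]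
    exact hint _
  -- The mgf of `L` is finite on all of ℝ, so the complex mgfs are entire; agreeing on ℝ, they agree
  -- at `I`, where they are the characteristic functions.
  have h3 := eqOn_complexMGF_of_mgf h1 (x := Complex.I) (by simp [h2])
  simpa only [complexMGF, charFunDual_apply, mul_comm] using h3

lemma tsum_pow_div_factorial_ofReal {a : ℝ} (ha : 0 ≤ a) :
    ∑' f : ℕ, ENNReal.ofReal a ^ f / (f.factorial : ℝ≥0∞) = ENNReal.ofReal (Real.exp a) := by
  have h := NormedSpace.expSeries_div_hasSum_exp a
  rw [← Real.exp_eq_exp_ℝ] at h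
  rw [← h.tsum_eq, ENNReal.ofReal_tsum_of_nonneg (fun n => by positivity) h.summable]
  refine tsum_congr fun f => ?_
  rw [ENNReal.ofReal_div_of_pos (by positivity), ENNReal.ofReal_pow ha, ENNReal.ofReal_natCast]

lemma integral_exp_mul_poissonMeasure (r : NNReal) (t : ℝ) :
    ∫ x, Real.exp (t * x) ∂((poissonMeasure r).map (fun k : ℕ => (k : ℝ))) =
      Real.exp (r * (Real.exp t - 1)) := by
  rw [integral_map .of_discrete (by fun_prop), integral_poissonMeasure]
  have h := NormedSpace.expSeries_div_hasSum_exp ((r : ℝ) * Real.exp t)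
  rw [← Real.exp_eq_exp_ℝ] at h
  have h2 := (h.mul_left (Real.exp (-r))).tsum_eq
  rw [← Real.exp_add] at h2
  rw [show (r : ℝ) * (Real.exp t - 1) = -r + r * Real.exp t by ring, ← h2]
  refine tsum_congr fun n => ?_
  rw [smul_eq_mul, mul_pow, ← Real.exp_nat_mul]
  ring_nf

variable {Ω E E' : Type*} [MeasurableSpace Ω] [MeasurableSpace E] [MeasurableSpace E']

lemma sum_dirac_apply (F : ℕ) (z : ℕ → E) {B : Set E} (hB : MeasurableSet B) :
    (∑ i ∈ Finset.range F, Measure.dirac (z i)) B =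
      ((∑ i ∈ Finset.range F, B.indicator (fun _ => 1) (z i) : ℕ) : ℝ≥0∞) := by
  classical
  rw [Measure.finsetSum_apply, Nat.cast_sum]
  refine Finset.sum_congr rfl fun i _ => ?_
  rw [Measure.dirac_apply' _ hB]
  by_cases h : z i ∈ B <;> simp [h]

/-- The image of a Poisson point process under a measurable map. -/
theorem IsPoissonPointProcess.map {P : Measure Ω} {ξ : Ω → Measure E} {ν : Measure E}
    (h : IsPoissonPointProcess P ξ ν) {φ : E → E'} (hφ : Measurable φ) :
    IsPoissonPointProcess P (fun ω => (ξ ω).map φ) (ν.map φ) where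
  measurable := (Measure.measurable_map φ hφ).comp h.measurable
  integer_valued ω B hB := by
    rw [Measure.map_apply hφ hB]
    exact h.integer_valued ω _ (hφ hB)
  poisson B hB := by
    simp only [Measure.map_apply hφ hB]
    exact h.poisson _ (hφ hB)
  infinite B hB := by
    simp only [Measure.map_apply hφ hB]
    exact h.infinite _ (hφ hB)
  indep m B hB hd := by
    simp only [Measure.map_apply hφ (hB _)]
    exact h.indep m _ (fun i => hφ (hB i)) fun i j hij => (hd hij).preimage φ

/-- By disjointness at most one indicator is nonzero at x. This makes ∫ g dν linear in the masses
ν(B i), so the joint mgf of the counts factors over i. -/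
lemma exp_sum_indicator {E : Type*} {m : ℕ} (B : Fin m → Set E) (hd : Pairwise (Function.onFun Disjoint B))
    (t : Fin m → ℝ) (x : E) :
    Real.exp (∑ i, t i * (B i).indicator (fun _ => 1) x) =
      1 + ∑ i, (Real.exp (t i) - 1) * (B i).indicator (fun _ => 1) x := by
  classical
  by_cases h : ∃ i, x ∈ B i
  · obtain ⟨i, hi⟩ := h
    have h0 : ∀ j, j ≠ i → (B j).indicator (fun _ => (1 : ℝ)) x = 0 := fun j hj =>
      Set.indicator_of_notMem (fun hx => Set.disjoint_left.1 (hd hj) hx hi) _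
    rw [Finset.sum_eq_single i (fun j _ hj => by rw [h0 j hj, mul_zero]) (by simp),
      Finset.sum_eq_single i (fun j _ hj => by rw [h0 j hj, mul_zero]) (by simp),
      Set.indicator_of_mem hi]
    ring_nf
  · push Not at h
    simp [h]

/-- A finite point process whose multiplicative functionals have the exponential form of a Poisson
process is a Poisson point process. -/
theorem isPoissonPointProcess_of_lintegral_prod {P : Measure Ω} [IsProbabilityMeasure P]
    {F : Ω → ℕ} {z : Ω → ℕ → E}
    (hm : Measurable fun ω => ∑ i ∈ Finset.range (F ω), Measure.dirac (z ω i))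
    {ν : Measure E} [IsFiniteMeasure ν] {c : ℝ≥0∞}
    (h : ∀ g : E → ℝ≥0∞, Measurable g → ∫⁻ x, g x ∂ν ≠ ⊤ →
      ∫⁻ ω, ∏ i ∈ Finset.range (F ω), g (z ω i) ∂P =
        c * ∑' f : ℕ, (∫⁻ x, g x ∂ν) ^ f / (f.factorial : ℝ≥0∞)) :
    IsPoissonPointProcess P (fun ω => ∑ i ∈ Finset.range (F ω), Measure.dirac (z ω i)) ν := by
  -- The test function 1 has expectation 1, which determines the constant `c`.
  have h1 := h (fun _ => 1) measurable_const (by simp)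
  simp only [Finset.prod_const_one, lintegral_const, measure_univ, mul_one, one_mul] at h1
  have hc : c = ENNReal.ofReal (Real.exp (-ν.real Set.univ)) := by
    rw [← ENNReal.ofReal_toReal (measure_ne_top ν Set.univ),
      tsum_pow_div_factorial_ofReal ENNReal.toReal_nonneg] at h1
    rw [Real.exp_neg, ENNReal.ofReal_inv_of_pos (Real.exp_pos _)]
    exact ENNReal.eq_inv_of_mul_eq_one_left h1.symm
  -- The joint law of the counts: m = 1 gives the Poisson marginals, general m gives independence.
  have key : ∀ (m : ℕ) (B : Fin m → Set E), (∀ i, MeasurableSet (B i)) →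
      Pairwise (Function.onFun Disjoint B) →
      P.map (fun ω i =>
        ((∑ k ∈ Finset.range (F ω), Measure.dirac (z ω k) : Measure E) (B i)).toReal) =
      Measure.pi fun i => (poissonMeasure (ν (B i)).toNNReal).map (fun k : ℕ => (k : ℝ)) := by
    intro m B hB hd
    have hY : Measurable fun ω (i : Fin m) =>
        ((∑ k ∈ Finset.range (F ω), Measure.dirac (z ω k) : Measure E) (B i)).toReal :=
      measurable_pi_lambda _ fun i => ((Measure.measurable_coe (hB i)).comp hm).ennreal_toReal
    have : IsProbabilityMeasure (P.map fun ω (i : Fin m) =>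
        ((∑ k ∈ Finset.range (F ω), Measure.dirac (z ω k) : Measure E) (B i)).toReal) :=
      Measure.isProbabilityMeasure_map hY.aemeasurable
    have hp : ∀ i, IsProbabilityMeasure
        ((poissonMeasure (ν (B i)).toNNReal).map (fun k : ℕ => (k : ℝ))) := fun i =>
      Measure.isProbabilityMeasure_map .of_discrete
    have hL : ∀ t : Fin m → ℝ, ∫⁻ ω, ENNReal.ofReal (Real.exp (∑ i, t i *
        ((∑ k ∈ Finset.range (F ω), Measure.dirac (z ω k) : Measure E) (B i)).toReal)) ∂P =
        ENNReal.ofReal (Real.exp (∑ i, ν.real (B i) * (Real.exp (t i) - 1))) := by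
      intro t
      -- For this g the product over the points is exp (∑ t i · count of B i), so the hypothesis
      -- computes the joint mgf.
      set g : E → ℝ := fun x => Real.exp (∑ i, t i * (B i).indicator (fun _ => 1) x) with hg
      have hgm : Measurable g := by
        refine Real.measurable_exp.comp (Finset.measurable_sum _ fun i _ => ?_)
        exact (measurable_const.indicator (hB i)).const_mul _
      have hprod : ∀ ω, ENNReal.ofReal (Real.exp (∑ i, t i *
          ((∑ k ∈ Finset.range (F ω), Measure.dirac (z ω k) : Measure E) (B i)).toReal)) =
          ∏ k ∈ Finset.range (F ω), ENNReal.ofReal (g (z ω k)) := by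
        intro ω
        rw [← ENNReal.ofReal_prod_of_nonneg fun _ _ => (Real.exp_pos _).le]
        rw [← Real.exp_sum, Finset.sum_comm]
        congr 2
        refine Finset.sum_congr rfl fun i _ => ?_
        rw [sum_dirac_apply _ _ (hB i), ENNReal.toReal_natCast, ← Finset.mul_sum, Nat.cast_sum]
        congr 1
        refine Finset.sum_congr rfl fun k _ => ?_
        by_cases hk : z ω k ∈ B i <;> simp [hk]
      have hgi : Integrable g ν ∧ ∫ x, g x ∂ν = ν.real Set.univ +
          ∑ i, ν.real (B i) * (Real.exp (t i) - 1) := by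
        have hi : ∀ i, Integrable (fun x => (Real.exp (t i) - 1) *
            (B i).indicator (fun _ => (1 : ℝ)) x) ν := fun i =>
          ((integrable_const (1 : ℝ)).indicator (hB i)).const_mul _
        have hgeq : g = fun x => 1 + ∑ i, (Real.exp (t i) - 1) *
            (B i).indicator (fun _ => 1) x := funext fun x => exp_sum_indicator B hd t x
        rw [hgeq]
        refine ⟨(integrable_const _).add (integrable_finsetSum _ fun i _ => hi i), ?_⟩
        rw [integral_add (integrable_const _) (integrable_finsetSum _ fun i _ => hi i),
          integral_finsetSum _ fun i _ => hi i]
        simp only [integral_const, smul_eq_mul, mul_one, integral_const_mul]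
        congr 1
        refine Finset.sum_congr rfl fun i _ => ?_
        rw [integral_indicator_const _ (hB i), smul_eq_mul, mul_one, mul_comm]
      have hgL := ofReal_integral_eq_lintegral_ofReal hgi.1
        (ae_of_all _ fun x => (Real.exp_pos _).le)
      rw [lintegral_congr hprod, h _ hgm.ennreal_ofReal (by rw [← hgL]; exact ENNReal.ofReal_ne_top),
        ← hgL,
        tsum_pow_div_factorial_ofReal (integral_nonneg fun x => (Real.exp_pos _).le), hc,
        ← ENNReal.ofReal_mul (Real.exp_pos _).le, ← Real.exp_add, hgi.2]
      congr 2
      ring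
    have hexp : ∀ t : Fin m → ℝ, Measurable fun x : Fin m → ℝ => Real.exp (∑ i, t i * x i) :=
      fun t => by fun_prop
    refine ext_of_mgf_pi (fun t => ?_) fun t => ?_
    · rw [integrable_map_measure (hexp t).aestronglyMeasurable hY.aemeasurable]
      refine ⟨((hexp t).comp hY).aestronglyMeasurable, ?_⟩
      simp only [Function.comp_def]
      rw [hasFiniteIntegral_iff_ofReal (ae_of_all _ fun x => (Real.exp_pos _).le)]
      rw [hL t]
      exact ENNReal.ofReal_lt_top
    · rw [integral_map hY.aemeasurable (hexp t).aestronglyMeasurable,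
        integral_eq_lintegral_of_nonneg_ae (ae_of_all _ fun x => (Real.exp_pos _).le)
          ((hexp t).comp hY).aestronglyMeasurable, hL t,
        ENNReal.toReal_ofReal (Real.exp_pos _).le]
      simp_rw [Real.exp_sum]
      rw [integral_fintype_prod_eq_prod (fun i (y : ℝ) => Real.exp (t i * y))]
      refine Finset.prod_congr rfl fun i _ => ?_
      rw [integral_exp_mul_poissonMeasure]
      rfl
  -- The counts are finite, so nothing is lost in passing through real numbers.
  have hcast : ∀ ω B, MeasurableSet B →
      ENNReal.ofReal ((∑ k ∈ Finset.range (F ω), Measure.dirac (z ω k) : Measure E) B).toReal =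
      (∑ k ∈ Finset.range (F ω), Measure.dirac (z ω k) : Measure E) B := fun ω B hB => by
    rw [ENNReal.ofReal_toReal]
    rw [sum_dirac_apply _ _ hB]
    exact ENNReal.natCast_ne_top _
  refine ⟨hm, fun ω B hB => ⟨_, (sum_dirac_apply (F ω) (z ω) hB).trans (ENat.toENNReal_coe _).symm⟩, fun B hB _ => ?_,
    fun B _ htop => absurd htop (measure_ne_top ν B), fun m B hB hd => ?_⟩
  · have hY : Measurable fun ω =>
        ((∑ k ∈ Finset.range (F ω), Measure.dirac (z ω k) : Measure E) B).toReal :=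
      ((Measure.measurable_coe hB).comp hm).ennreal_toReal
    have := key 1 (fun _ => B) (fun _ => hB) (fun i j hij => absurd (Subsingleton.elim i j) hij)
    have hp : IsProbabilityMeasure
        ((poissonMeasure (ν B).toNNReal).map (fun k : ℕ => (k : ℝ))) :=
      Measure.isProbabilityMeasure_map .of_discrete
    have h2 := congrArg (Measure.map (Function.eval 0)) this
    rw [Measure.map_map (measurable_pi_apply 0) (measurable_pi_lambda _ fun _ => hY),
      (measurePreserving_eval _ (0 : Fin 1)).map_eq] at h2
    replace h2 := congrArg (Measure.map ENNReal.ofReal) h2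
    rw [Measure.map_map ENNReal.measurable_ofReal
      ((measurable_pi_apply 0).comp (measurable_pi_lambda _ fun _ => hY)),
      Measure.map_map ENNReal.measurable_ofReal .of_discrete] at h2
    convert! h2 using 2
    · funext ω
      exact (hcast ω B hB).symm
    · funext k
      simp
  · have hY : ∀ i : Fin m, Measurable fun ω =>
        ((∑ k ∈ Finset.range (F ω), Measure.dirac (z ω k) : Measure E) (B i)).toReal :=
      fun i => ((Measure.measurable_coe (hB i)).comp hm).ennreal_toReal
    have hp : ∀ i, IsProbabilityMeasure
        ((poissonMeasure (ν (B i)).toNNReal).map (fun k : ℕ => (k : ℝ))) := fun i =>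
      Measure.isProbabilityMeasure_map .of_discrete
    have hI : iIndepFun (fun (i : Fin m) ω =>
        ((∑ k ∈ Finset.range (F ω), Measure.dirac (z ω k) : Measure E) (B i)).toReal) P := by
      rw [iIndepFun_iff_map_fun_eq_pi_map fun i => (hY i).aemeasurable, key m B hB hd]
      congr 1
      funext i
      have h2 := congrArg (Measure.map (Function.eval i)) (key m B hB hd)
      rw [Measure.map_map (measurable_pi_apply i) (measurable_pi_lambda _ hY),
        (measurePreserving_eval _ i).map_eq] at h2
      exact h2.symm
    have h4 := hI.comp (fun _ => ENNReal.ofReal) fun _ => ENNReal.measurable_ofReal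
    convert! h4 using 1
    funext i ω
    exact (hcast ω _ (hB i)).symm

end PoissonCharacterization

/-! ### Iterated integrals over ordered sequences -/

section OrderedIntegrals

variable {E κ : Type*} [MeasurableSpace E] [LinearOrder κ] [TopologicalSpace κ]
  [OrderClosedTopology κ] [SecondCountableTopology κ] [MeasurableSpace κ] [OpensMeasurableSpace κ]

/-- Integrating powers of the distribution function `G a = ν {σ ≤ a}` of a function `σ` without
atoms. -/
lemma lintegral_measure_le_pow {ν : Measure E} [IsFiniteMeasure ν] {σ : E → κ} (hσ : Measurable σ)
    (hν : ∀ a, ν {z | σ z = a} = 0) (k : ℕ) (a : κ) :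
    (k + 1) * ∫⁻ z in {z | σ z ≤ a}, ν {w | σ w ≤ σ z} ^ k ∂ν = ν {z | σ z ≤ a} ^ (k + 1) := by
  have hG : Measurable fun z => ν {w | σ w ≤ σ z} :=
    measurable_measure_prodMk_left
      (measurableSet_le (hσ.comp measurable_snd) (hσ.comp measurable_fst))
  have hle : ∀ a, MeasurableSet {z | σ z ≤ a} := fun a => measurableSet_le hσ measurable_const
  induction k generalizing a with
  | zero => simp
  | succ k ih =>
    set A := {z | σ z ≤ a} with hA
    -- Split A × A according to σ z ≤ σ y or σ y < σ z. The first part is evaluated by the induction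
    -- hypothesis (`h3` below); in the second, integrating out y contributes one more factor of the
    -- distribution function.
    have h1 : ν A * ∫⁻ z in A, ν {w | σ w ≤ σ z} ^ k ∂ν =
        ∫⁻ y in A, ∫⁻ z in {z | σ z ≤ σ y}, ν {w | σ w ≤ σ z} ^ k ∂ν ∂ν +
          ∫⁻ z in A, ν {w | σ w ≤ σ z} ^ (k + 1) ∂ν := by
      have hm1 : Measurable fun p : E × E =>
          {p : E × E | σ p.2 ≤ σ p.1}.indicator (fun p => ν {w | σ w ≤ σ p.2} ^ k) p :=
        ((hG.comp measurable_snd).pow_const k).indicator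
          (measurableSet_le (hσ.comp measurable_snd) (hσ.comp measurable_fst))
      have hm2 : Measurable fun p : E × E =>
          {p : E × E | σ p.1 < σ p.2}.indicator (fun p => ν {w | σ w ≤ σ p.2} ^ k) p :=
        ((hG.comp measurable_snd).pow_const k).indicator
          (measurableSet_lt (hσ.comp measurable_fst) (hσ.comp measurable_snd))
      calc ν A * ∫⁻ z in A, ν {w | σ w ≤ σ z} ^ k ∂ν
          = ∫⁻ _ in A, ∫⁻ z in A, ν {w | σ w ≤ σ z} ^ k ∂ν ∂ν := by
            rw [setLIntegral_const, mul_comm]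
        _ = ∫⁻ y in A, (∫⁻ z in A,
              {p : E × E | σ p.2 ≤ σ p.1}.indicator (fun p => ν {w | σ w ≤ σ p.2} ^ k) (y, z) ∂ν +
              ∫⁻ z in A, {p : E × E | σ p.1 < σ p.2}.indicator
                (fun p => ν {w | σ w ≤ σ p.2} ^ k) (y, z) ∂ν) ∂ν := by
            refine lintegral_congr fun y => ?_
            refine Eq.trans (lintegral_congr fun z => ?_)
              (lintegral_add_left (hm1.comp (measurable_prodMk_left (x := y))) _)
            simp only [Function.comp_apply]
            rcases le_or_gt (σ z) (σ y) with h | h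
            · simp [h, not_lt.2 h]
            · simp [h, not_le.2 h]
        _ = ∫⁻ y in A, ∫⁻ z in A,
              {p : E × E | σ p.2 ≤ σ p.1}.indicator (fun p => ν {w | σ w ≤ σ p.2} ^ k) (y, z) ∂ν
                ∂ν +
            ∫⁻ y in A, ∫⁻ z in A, {p : E × E | σ p.1 < σ p.2}.indicator
                (fun p => ν {w | σ w ≤ σ p.2} ^ k) (y, z) ∂ν ∂ν :=
            lintegral_add_left hm1.lintegral_prod_right' _
        _ = _ := by
            congr 1
            · refine setLIntegral_congr_fun (hle a) fun y hy => ?_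
              have : ∀ z, {p : E × E | σ p.2 ≤ σ p.1}.indicator
                  (fun p => ν {w | σ w ≤ σ p.2} ^ k) (y, z) =
                  {z | σ z ≤ σ y}.indicator (fun z => ν {w | σ w ≤ σ z} ^ k) z := fun z => by
                by_cases h : σ z ≤ σ y <;> simp [h]
              simp only [this]
              rw [setLIntegral_indicator (hle _)]
              congr 2
              ext z
              exact ⟨fun h => h.1, fun h => ⟨h, le_trans h hy⟩⟩
            · rw [lintegral_lintegral_swap hm2.aemeasurable]
              refine setLIntegral_congr_fun (hle a) fun z hz => ?_
              have : ∀ y, {p : E × E | σ p.1 < σ p.2}.indicator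
                  (fun p => ν {w | σ w ≤ σ p.2} ^ k) (y, z) =
                  {y | σ y < σ z}.indicator (fun _ => ν {w | σ w ≤ σ z} ^ k) y := fun y => by
                by_cases h : σ y < σ z <;> simp [h]
              simp only [this]
              have hlt : MeasurableSet {y | σ y < σ z} := measurableSet_lt hσ measurable_const
              rw [setLIntegral_indicator hlt, setLIntegral_const, pow_succ]
              congr 1
              have h3 : {y | σ y < σ z} ∩ A = {y | σ y < σ z} :=
                Set.inter_eq_left.2 fun y hy => le_trans (le_of_lt hy) hz
              rw [h3]
              -- The absence of atoms lets < replace ≤ here.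
              refine le_antisymm (measure_mono fun y hy => le_of_lt hy) ?_
              calc ν {w | σ w ≤ σ z} ≤ ν ({y | σ y < σ z} ∪ {y | σ y = σ z}) :=
                    measure_mono fun y hy => lt_or_eq_of_le hy
                _ ≤ _ := measure_union_le _ _
                _ = _ := by rw [hν, add_zero]
    have h2 : ν A ^ (k + 1 + 1) = (k + 1) * (ν A * ∫⁻ z in A, ν {w | σ w ≤ σ z} ^ k ∂ν) := by
      rw [pow_succ, ← ih a]
      ring
    have h3 : (k + 1) * ∫⁻ y in A, ∫⁻ z in {z | σ z ≤ σ y}, ν {w | σ w ≤ σ z} ^ k ∂ν ∂ν =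
        ∫⁻ z in A, ν {w | σ w ≤ σ z} ^ (k + 1) ∂ν := by
      rw [← lintegral_const_mul' _ _ (by finiteness)]
      simp only [ih]
    rw [h2, h1, mul_add, h3]
    push_cast
    ring

/-- The iterated integrals over `σ` non-increasing sequences. -/
lemma iterated_lintegral_eq {ν : Measure E} [IsFiniteMeasure ν] {σ : E → κ} (hσ : Measurable σ)
    (hν : ∀ a, ν {z | σ z = a} = 0) {H : ℕ → κ → ℝ≥0∞} (h0 : ∀ a, H 0 a = 1)
    (hs : ∀ f a, H (f + 1) a = ∫⁻ z in {z | σ z ≤ a}, H f (σ z) ∂ν) (f : ℕ) (a : κ) :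
    H f a = ν {z | σ z ≤ a} ^ f / (f.factorial : ℝ≥0∞) := by
  induction f generalizing a with
  | zero => simp [h0]
  | succ f ih =>
    rw [hs]
    simp only [ih, ENNReal.div_eq_inv_mul]
    rw [lintegral_const_mul' _ _ (by simp [Nat.factorial_ne_zero]),
      ← lintegral_measure_le_pow hσ hν f a, Nat.factorial_succ, Nat.cast_mul,
      ENNReal.mul_inv (by simp) (by simp), ← mul_assoc]
    congr 1
    push_cast
    rw [mul_right_comm, ENNReal.inv_mul_cancel (by simp) (by finiteness), one_mul]

end OrderedIntegrals

/-! ### Deterministic structure of the concave majorant and its first face -/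

section Faces

/-- An affine function is concave, so a supporting line at j is a competitor that bounds the least
concave majorant there. -/
lemma mem_meetSet_of_line {s : ℕ → ℝ} {n j : ℕ} (hj : j ≤ n) (b : ℝ)
    (h : ∀ k ≤ n, s k ≤ s j + b * ((k : ℝ) - j)) : j ∈ meetSet s n := by
  obtain ⟨-, h2, h3⟩ := concaveMajorant_spec s n
  refine ⟨hj, le_antisymm (h2 j hj) ?_⟩
  have hC : ConcaveOn ℝ (Set.Icc 0 (n : ℝ)) fun t => s j + b * (t - j) := by
    refine ⟨convex_Icc _ _, fun x _ y _ a c _ _ hac => le_of_eq ?_⟩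
    simp only [smul_eq_mul]
    linear_combination (s j - b * j) * hac
  have := h3 _ hC h j ⟨Nat.cast_nonneg j, Nat.cast_le.2 hj⟩
  simpa using this

/-- A path meets its concave majorant at `j` if and only if the chords to the right of `j` are at
most as steep as the chords to the left of `j`. -/
lemma mem_meetSet_iff {s : ℕ → ℝ} {n j : ℕ} :
    j ∈ meetSet s n ↔ j ≤ n ∧ ∀ i k : ℕ, i < j → j < k → k ≤ n →
      (s k - s j) * ((j : ℝ) - i) ≤ (s j - s i) * ((k : ℝ) - j) := by
  constructor
  · rintro ⟨hj, h⟩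
    refine ⟨hj, fun i k hij hjk hk => ?_⟩
    obtain ⟨h1, h2, -⟩ := concaveMajorant_spec s n
    have hij' : (i : ℝ) < j := Nat.cast_lt.2 hij
    have hjk' : (j : ℝ) < k := Nat.cast_lt.2 hjk
    have hk' : (k : ℝ) ≤ n := Nat.cast_le.2 hk
    have hi0 : (0 : ℝ) ≤ i := Nat.cast_nonneg i
    have hpos : (0 : ℝ) < k - i := by linarith
    have h3 := h1.2 (show (i : ℝ) ∈ Set.Icc 0 (n : ℝ) from ⟨hi0, by linarith⟩)
      (show (k : ℝ) ∈ Set.Icc 0 (n : ℝ) from ⟨by linarith, hk'⟩)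
      (show (0 : ℝ) ≤ (k - j) / (k - i) by apply div_nonneg <;> linarith)
      (show (0 : ℝ) ≤ (j - i) / (k - i) by apply div_nonneg <;> linarith)
      (by field_simp; ring)
    have h4 : ((k : ℝ) - j) / (k - i) * i + (j - i) / (k - i) * k = j := by field_simp; ring
    simp only [smul_eq_mul] at h3
    rw [h4, ← h, div_mul_eq_mul_div, div_mul_eq_mul_div, ← add_div, div_le_iff₀ hpos] at h3
    have h5 := mul_le_mul_of_nonneg_left (h2 i (by omega)) (sub_nonneg.2 hjk'.le)
    have h6 := mul_le_mul_of_nonneg_left (h2 k hk) (sub_nonneg.2 hij'.le)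
    linarith
  · rintro ⟨hj, h⟩
    suffices hb : ∃ b : ℝ, (∀ k : ℕ, j < k → k ≤ n → s k - s j ≤ b * ((k : ℝ) - j)) ∧
        ∀ i : ℕ, i < j → b * ((j : ℝ) - i) ≤ s j - s i by
      obtain ⟨b, hb1, hb2⟩ := hb
      refine mem_meetSet_of_line hj b fun k hk => ?_
      rcases lt_trichotomy k j with hkj | rfl | hkj
      · linarith [hb2 k hkj]
      · simp
      · linarith [hb1 k hkj hk]
    -- The supporting slope is the steepest chord to the right of j; if j = n there is none, and the
    -- least steep chord to the left is used.
    rcases hj.lt_or_eq with hjn | rfl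
    · obtain ⟨k, hk, hmax⟩ := (Finset.Ioc j n).exists_max_image
        (fun k => (s k - s j) / ((k : ℝ) - j)) ⟨n, by simp [hjn]⟩
      rw [Finset.mem_Ioc] at hk
      have hjk : (0 : ℝ) < k - j := sub_pos.2 (Nat.cast_lt.2 hk.1)
      refine ⟨(s k - s j) / ((k : ℝ) - j), fun m hm hmn => ?_, fun i hi => ?_⟩
      · have := hmax m (Finset.mem_Ioc.2 ⟨hm, hmn⟩)
        rwa [div_le_iff₀ (sub_pos.2 (Nat.cast_lt.2 hm))] at this
      · rw [div_mul_eq_mul_div, div_le_iff₀ hjk]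
        exact h i k hi hk.1 hk.2
    · rcases Nat.eq_zero_or_pos j with rfl | hj0
      · exact ⟨0, fun k hk hk' => by omega, fun i hi => by omega⟩
      · obtain ⟨i, hi, hmin⟩ := (Finset.range j).exists_min_image
          (fun i => (s j - s i) / ((j : ℝ) - i)) ⟨0, by simp [hj0]⟩
        refine ⟨(s j - s i) / ((j : ℝ) - i), fun k hk hk' => by omega, fun m hm => ?_⟩
        have := hmin m (Finset.mem_range.2 hm)
        rwa [le_div_iff₀ (sub_pos.2 (Nat.cast_lt.2 hm))] at this

lemma zero_mem_meetSet (s : ℕ → ℝ) (n : ℕ) : 0 ∈ meetSet s n :=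
  mem_meetSet_iff.2 ⟨Nat.zero_le n, fun i k hi => by omega⟩

lemma self_mem_meetSet (s : ℕ → ℝ) (n : ℕ) : n ∈ meetSet s n :=
  mem_meetSet_iff.2 ⟨le_rfl, fun i k _ hk hk' => by omega⟩

lemma meetTime_zero (s : ℕ → ℝ) (n : ℕ) : meetTime s n 0 = 0 :=
  Nat.nth_zero_of_zero (zero_mem_meetSet s n)

lemma ncard_meetSet_pos (s : ℕ → ℝ) (n : ℕ) : 0 < (meetSet s n).ncard :=
  (Set.ncard_pos (meetSet_finite s n)).2 ⟨0, zero_mem_meetSet s n⟩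

lemma numFaces_add_one (s : ℕ → ℝ) (n : ℕ) : numFaces s n + 1 = (meetSet s n).ncard := by
  have := ncard_meetSet_pos s n
  unfold numFaces
  omega

lemma card_toFinset_meetSet (s : ℕ → ℝ) (n : ℕ)
    (hf : (Set.ofPred fun j => j ∈ meetSet s n).Finite) : hf.toFinset.card = numFaces s n + 1 := by
  rw [numFaces_add_one, ← Set.ncard_eq_toFinset_card _ hf]
  rfl

lemma meetTime_numFaces (s : ℕ → ℝ) (n : ℕ) : meetTime s n (numFaces s n) = n := by
  classical
  have h1 : Nat.count (fun j => j ∈ meetSet s n) (n + 1) = (meetSet s n).ncard := by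
    rw [Nat.count_eq_card_filter_range, ← Set.ncard_coe_finset]
    congr 1
    ext j
    simp only [Finset.coe_filter, Finset.mem_range, Set.mem_ofPred_eq]
    exact ⟨fun h => h.2, fun h => ⟨Nat.lt_succ_of_le h.1, h⟩⟩
  rw [Nat.count_succ, if_pos (self_mem_meetSet s n), ← numFaces_add_one] at h1
  rw [← Nat.succ_injective h1]
  exact Nat.nth_count (p := fun j => j ∈ meetSet s n) (self_mem_meetSet s n)

/-- The first face of the concave majorant on `[0, n]` of a path from `0` has length `l`: before
`l` the path is strictly below the line through `0` and `(l, s l)`, after `l` it is not above it. -/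
structure IsFirstFace (s : ℕ → ℝ) (n l : ℕ) : Prop where
  pos : 0 < l
  le : l ≤ n
  below : ∀ k : ℕ, 1 ≤ k → k < l → s k < (k : ℝ) / l * s l
  after : ∀ k : ℕ, 1 ≤ k → l + k ≤ n → s (l + k) - s l ≤ k * (s l / l)

/-- Take the least l at which s l / l is maximal: minimality gives the strict inequality before l,
maximality the weak one after l. No assumption on ties is needed. -/
lemma exists_isFirstFace (s : ℕ → ℝ) {n : ℕ} (hn : 0 < n) : ∃ l, IsFirstFace s n l := by
  classical
  obtain ⟨m, hm, hmax⟩ := (Finset.Icc 1 n).exists_max_image (fun k => s k / (k : ℝ)) ⟨n, by simp; omega⟩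
  have hex : ∃ l, 1 ≤ l ∧ l ≤ n ∧ s m / m ≤ s l / l := ⟨m, by simp_all⟩
  obtain ⟨h1, h2, h3⟩ := Nat.find_spec hex
  have hmin := fun k => Nat.find_min hex (m := k)
  set l := Nat.find hex
  have hl : (0 : ℝ) < l := Nat.cast_pos.2 h1
  refine ⟨l, h1, h2, fun k hk hkl => ?_, fun k hk hkn => ?_⟩
  · have h4 : s k / k < s m / m := by
      by_contra! h
      exact hmin k hkl ⟨hk, by omega, h⟩
    have hk' : (0 : ℝ) < k := Nat.cast_pos.2 hk
    have := (div_lt_iff₀ hk').1 (h4.trans_le h3)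
    linarith [show (k : ℝ) / l * s l = s l / l * k by ring]
  · have h4 := (hmax (l + k) (by simp; omega)).trans h3
    push_cast at h4
    rw [div_le_iff₀ (by positivity)] at h4
    have : s l / l * (l + k) = s l + k * (s l / l) := by field_simp
    linarith

/-- If l < l', then strictness before l' at time l and the weak bound after l at time l' compare s l
/ l with s l' / l' in opposite ways. -/
lemma IsFirstFace.unique {s : ℕ → ℝ} {n l l' : ℕ} (h : IsFirstFace s n l)
    (h' : IsFirstFace s n l') : l = l' := by
  wlog hlt : l < l' generalizing l l'
  · rcases lt_trichotomy l l' with h1 | h1 | h1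
    · exact absurd h1 hlt
    · exact h1
    · exact (this h' h h1).symm
  exfalso
  have h1 := h'.below l h.pos hlt
  have h2 := h.after (l' - l) (by omega) (by have := h'.le; omega)
  rw [Nat.add_sub_cancel' hlt.le, Nat.cast_sub hlt.le] at h2
  have hl : (0 : ℝ) < l := Nat.cast_pos.2 h.pos
  have hl' : (0 : ℝ) < l' := Nat.cast_pos.2 h'.pos
  have h3 : s l' * l ≤ l' * s l := by
    have : ((l' : ℝ) - l) * (s l / l) = l' * s l / l - s l := by field_simp
    rw [← le_div_iff₀ hl]
    linarith
  rw [div_mul_eq_mul_div, lt_div_iff₀ hl'] at h1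
  linarith

/-- The path `s` restarted at time `l`. -/
def restart (s : ℕ → ℝ) (l k : ℕ) : ℝ := s (l + k) - s l

section FirstFace

variable {s : ℕ → ℝ} {n l : ℕ}

lemma IsFirstFace.le_line (h : IsFirstFace s n l) (h0 : s 0 = 0) {k : ℕ} (hk : k ≤ n) :
    s k ≤ s l + s l / l * ((k : ℝ) - l) := by
  have hl : (0 : ℝ) < l := Nat.cast_pos.2 h.pos
  have h1 : s l + s l / l * ((k : ℝ) - l) = k / l * s l := by field_simp; ring
  rcases Nat.eq_zero_or_pos k with rfl | hk0
  · rw [h1]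
    simp [h0]
  rcases lt_trichotomy k l with hkl | rfl | hkl
  · rw [h1]
    exact (h.below k hk0 hkl).le
  · simp
  · have := h.after (k - l) (by omega) (by omega)
    rw [Nat.add_sub_cancel' hkl.le, Nat.cast_sub hkl.le] at this
    linarith

/-- The chord criterion at l + j also involves times i < l, which the restarted path does not see.
They impose nothing new: chords from such i to l are at least as steep as the first face, and chords
starting at l are at most as steep. -/
lemma IsFirstFace.add_mem_meetSet_iff (h : IsFirstFace s n l) (h0 : s 0 = 0) (j : ℕ) :
    l + j ∈ meetSet s n ↔ j ∈ meetSet (restart s l) (n - l) := by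
  have hln := h.le
  rw [mem_meetSet_iff, mem_meetSet_iff]
  constructor
  · rintro ⟨h1, h2⟩
    refine ⟨by omega, fun i k hi hk hkn => ?_⟩
    have := h2 (l + i) (l + k) (by omega) (by omega) (by omega)
    simp only [restart]
    push_cast at this
    linarith
  · rintro ⟨h1, h2⟩
    refine ⟨by omega, fun i k hi hk hkn => ?_⟩
    obtain ⟨k, rfl⟩ : ∃ k', k = l + k' := ⟨k - l, by omega⟩
    have hjk : (0 : ℝ) < k - j := sub_pos.2 (Nat.cast_lt.2 (by omega))
    have hline := fun m hm => h.le_line h0 (k := m) hm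
    rcases le_or_gt l i with hli | hli
    · obtain ⟨i, rfl⟩ : ∃ i', i = l + i' := ⟨i - l, by omega⟩
      have := h2 i k (by omega) (by omega) (by omega)
      simp only [restart] at this
      push_cast
      linarith
    · have hi' := hline i (by omega)
      have hil : (0 : ℝ) < l - i := sub_pos.2 (Nat.cast_lt.2 hli)
      rcases Nat.eq_zero_or_pos j with rfl | hj
      · have hk' := hline (l + k) hkn
        push_cast at hk' ⊢
        simp only [add_zero] at *
        have h3 : (s (l + k) - s l) * ((l : ℝ) - i) ≤ (s l / l * k) * (l - i) :=
          mul_le_mul_of_nonneg_right (by linarith) hil.le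
        have h4 : (s l / l * (l - i)) * (k : ℝ) ≤ (s l - s i) * k :=
          mul_le_mul_of_nonneg_right (by linarith) (Nat.cast_nonneg k)
        linarith
      · have hj' := hline (l + j) (by omega)
        have h3 := h2 0 k hj (by omega) (by omega)
        simp only [restart] at h3
        push_cast at hj' h3 ⊢
        simp only [add_zero, sub_self, sub_zero] at h3
        have hj0 : (0 : ℝ) < j := Nat.cast_pos.2 hj
        have h4 : (s (l + j) - s l) * ((l : ℝ) - i) ≤ (s l - s i) * j := by
          have h5 : (s (l + j) - s l) * ((l : ℝ) - i) ≤ (s l / l * j) * (l - i) :=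
            mul_le_mul_of_nonneg_right (by linarith) hil.le
          have h6 : (s l / l * (l - i)) * (j : ℝ) ≤ (s l - s i) * j :=
            mul_le_mul_of_nonneg_right (by linarith) hj0.le
          linarith
        have h7 := mul_le_mul_of_nonneg_right h3 hil.le
        have h8 := mul_le_mul_of_nonneg_right h4 hjk.le
        -- The slopes decrease along i → l → l + j → l + k; the factor j clears the denominator of
        -- the middle one.
        refine le_of_mul_le_mul_right (a := (j : ℝ)) ?_ hj0
        linarith [mul_le_mul_of_nonneg_right h3 hj0.le]

lemma IsFirstFace.notMem_meetSet (h : IsFirstFace s n l) (h0 : s 0 = 0) {j : ℕ} (hj : 0 < j)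
    (hjl : j < l) : j ∉ meetSet s n := by
  intro hmem
  have h1 := (mem_meetSet_iff.1 hmem).2 0 l hj hjl h.le
  have h2 := h.below j hj hjl
  have hl : (0 : ℝ) < l := Nat.cast_pos.2 h.pos
  rw [div_mul_eq_mul_div, lt_div_iff₀ hl] at h2
  rw [h0] at h1
  push_cast at h1
  linarith

lemma IsFirstFace.meetSet_eq (h : IsFirstFace s n l) (h0 : s 0 = 0) :
    meetSet s n = insert 0 ((l + ·) '' meetSet (restart s l) (n - l)) := by
  ext j
  simp only [Set.mem_insert_iff, Set.mem_image]
  constructor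
  · intro hj
    by_cases hj0 : j = 0
    · exact Or.inl hj0
    have hlj : l ≤ j := not_lt.1 fun hlt => h.notMem_meetSet h0 (Nat.pos_of_ne_zero hj0) hlt hj
    obtain ⟨k, rfl⟩ := Nat.exists_eq_add_of_le hlj
    exact Or.inr ⟨k, (h.add_mem_meetSet_iff h0 k).1 hj, rfl⟩
  · rintro (rfl | ⟨k, hk, rfl⟩)
    · exact zero_mem_meetSet s n
    · exact (h.add_mem_meetSet_iff h0 k).2 hk

lemma IsFirstFace.numFaces_eq (h : IsFirstFace s n l) (h0 : s 0 = 0) :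
    numFaces s n = numFaces (restart s l) (n - l) + 1 := by
  apply Nat.succ_injective
  have hl := h.pos
  have hnm : 0 ∉ (l + ·) '' meetSet (restart s l) (n - l) := by
    rintro ⟨k, -, hk⟩
    simp only at hk
    omega
  rw [Nat.succ_eq_add_one, Nat.succ_eq_add_one, numFaces_add_one, numFaces_add_one,
    h.meetSet_eq h0, Set.ncard_insert_of_notMem hnm ((meetSet_finite _ _).image _),
    Set.ncard_image_of_injective _ (add_right_injective l)]

lemma IsFirstFace.meetTime_succ (h : IsFirstFace s n l) (h0 : s 0 = 0) {i : ℕ}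
    (hi : i ≤ numFaces (restart s l) (n - l)) :
    meetTime s n (i + 1) = l + meetTime (restart s l) (n - l) i := by
  classical
  have hf : (Set.ofPred fun j => j ∈ meetSet (restart s l) (n - l)).Finite := meetSet_finite _ _
  have hc : i < hf.toFinset.card := by
    rw [card_toFinset_meetSet]
    omega
  -- Time 0 is the only meeting time before l, hence the index shift by one.
  have h1 : Nat.count (fun j => j ∈ meetSet s n) l = 1 := by
    rw [Nat.count_eq_card_filter_range, Finset.card_eq_one]
    refine ⟨0, Finset.ext fun j => ?_⟩
    simp only [Finset.mem_filter, Finset.mem_range, Finset.mem_singleton]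
    constructor
    · rintro ⟨hjl, hj⟩
      by_contra hj0
      exact h.notMem_meetSet h0 (Nat.pos_of_ne_zero hj0) hjl hj
    · rintro rfl
      exact ⟨h.pos, zero_mem_meetSet s n⟩
  have h2 : Nat.count (fun j => j ∈ meetSet s n) (l + meetTime (restart s l) (n - l) i) =
      i + 1 := by
    have h3 : (fun k => l + k ∈ meetSet s n) = fun k => k ∈ meetSet (restart s l) (n - l) :=
      funext fun k => propext (h.add_mem_meetSet_iff h0 k)
    rw [Nat.count_add, h1, add_comm]
    congr 1
    simp only [h3]
    exact Nat.count_nth_of_lt_card_finite hf hc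
  have h4 : l + meetTime (restart s l) (n - l) i ∈ meetSet s n :=
    (h.add_mem_meetSet_iff h0 _).2 (Nat.nth_mem_of_lt_card hf hc)
  rw [← h2]
  exact Nat.nth_count (p := fun j => j ∈ meetSet s n) h4

lemma IsFirstFace.faceSegment_zero {l : ℕ+} (h : IsFirstFace s n l) (h0 : s 0 = 0) :
    faceSegment s n 0 = initialSegment s l := by
  have h1 : meetTime s n 1 = l := by
    rw [h.meetTime_succ h0 (Nat.zero_le _), meetTime_zero, add_zero]
  have h2 : faceLength s n 0 = l := by
    rw [faceLength, zero_add, h1, meetTime_zero, Nat.sub_zero, PNat.coe_toPNat']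
  rw [faceSegment, h2, meetTime_zero]
  simp [h0]

lemma IsFirstFace.faceSegment_succ (h : IsFirstFace s n l) (h0 : s 0 = 0) {i : ℕ}
    (hi : i < numFaces (restart s l) (n - l)) :
    faceSegment s n (i + 1) = faceSegment (restart s l) (n - l) i := by
  have h1 := h.meetTime_succ h0 hi.le
  have h2 := h.meetTime_succ h0 (Nat.succ_le_of_lt hi)
  have h3 : faceLength s n (i + 1) = faceLength (restart s l) (n - l) i := by
    rw [faceLength, faceLength, h1, h2, Nat.add_sub_add_left]
  rw [faceSegment, faceSegment, h3, h1]
  congr 1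
  funext k
  simp [restart, add_assoc]

/-- Multiplicative functionals of the path segments factor at the end of the first face. -/
lemma IsFirstFace.prod_faceSegment {M : Type*} [CommMonoid M] {l : ℕ+} (h : IsFirstFace s n l)
    (h0 : s 0 = 0) (g : PathSegment → M) :
    ∏ i ∈ Finset.range (numFaces s n), g (faceSegment s n i) =
      g (initialSegment s l) * ∏ i ∈ Finset.range (numFaces (restart s l) (n - l)),
        g (faceSegment (restart s l) (n - l) i) := by
  rw [h.numFaces_eq h0, Finset.prod_range_succ', h.faceSegment_zero h0, mul_comm]
  congr 1
  exact Finset.prod_congr rfl fun i hi => by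
    rw [h.faceSegment_succ h0 (Finset.mem_range.1 hi)]

end FirstFace

end Faces

/-! ### Resampling and shifting i.i.d. sequences -/

section ProductMeasure

lemma measurable_piecewise_pi {ι : Type*} {α : ι → Type*} [∀ i, MeasurableSpace (α i)]
    (S : Set ι) [DecidablePred (· ∈ S)] :
    Measurable fun p : (∀ i, α i) × (∀ i, α i) => S.piecewise p.1 p.2 := by
  refine measurable_pi_lambda _ fun i => ?_
  by_cases hi : i ∈ S
  · simp only [Set.piecewise_eq_of_mem _ _ _ hi]
    fun_prop
  · simp only [Set.piecewise_eq_of_notMem _ _ _ hi]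
    fun_prop

/-- Two independent samples of a product measure, glued along a set of coordinates, form a sample
of the product measure. -/
lemma map_piecewise_infinitePi_prod {ι : Type*} {α : ι → Type*} [∀ i, MeasurableSpace (α i)]
    (μ : ∀ i, Measure (α i)) [∀ i, IsProbabilityMeasure (μ i)] (S : Set ι)
    [DecidablePred (· ∈ S)] :
    ((Measure.infinitePi μ).prod (Measure.infinitePi μ)).map (fun p => S.piecewise p.1 p.2) =
      Measure.infinitePi μ := by
  have hm := measurable_piecewise_pi (α := α) S
  refine Measure.eq_infinitePi μ fun s t ht => ?_
  rw [Measure.map_apply hm (MeasurableSet.pi s.countable_toSet fun i _ => ht i)]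
  have hpre : (fun p : (∀ i, α i) × (∀ i, α i) => S.piecewise p.1 p.2) ⁻¹' Set.pi s t =
      Set.pi (s.filter (· ∈ S)) t ×ˢ Set.pi (s.filter (· ∉ S)) t := by
    ext p
    simp only [Set.mem_preimage, Set.mem_pi, Set.mem_prod, Finset.coe_filter, Set.mem_ofPred_eq,
      Finset.mem_coe]
    constructor
    · intro h
      refine ⟨fun i hi => ?_, fun i hi => ?_⟩
      · simpa [hi.2] using h i hi.1
      · simpa [hi.2] using h i hi.1
    · rintro ⟨h1, h2⟩ i hi
      by_cases hS : i ∈ S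
      · simpa [hS] using h1 i ⟨hi, hS⟩
      · simpa [hS] using h2 i ⟨hi, hS⟩
  rw [hpre, Measure.prod_prod, Measure.infinitePi_pi _ fun i _ => ht i,
    Measure.infinitePi_pi _ fun i _ => ht i, Finset.prod_filter_mul_prod_filter_not]

/-- Resampling the single coordinate a independently preserves the product law, so Fubini reduces
nullity to the sections along a. -/
lemma infinitePi_eq_zero_of_update {ι : Type*} [DecidableEq ι] {α : ι → Type*}
    [∀ i, MeasurableSpace (α i)] (μ : ∀ i, Measure (α i)) [∀ i, IsProbabilityMeasure (μ i)]
    {T : Set (∀ i, α i)} (hT : MeasurableSet T) (a : ι)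
    (h : ∀ y, μ a {u | Function.update y a u ∈ T} = 0) : Measure.infinitePi μ T = 0 := by
  classical
  have hm := measurable_piecewise_pi (α := α) ({a}ᶜ : Set ι)
  rw [← map_piecewise_infinitePi_prod μ ({a}ᶜ), Measure.map_apply hm hT,
    Measure.measure_prod_null (hm hT)]
  refine ae_of_all _ fun y => ?_
  have hpre : Prod.mk y ⁻¹' ((fun p : (∀ i, α i) × (∀ i, α i) =>
      ({a}ᶜ : Set ι).piecewise p.1 p.2) ⁻¹' T) =
      Function.eval a ⁻¹' {u | Function.update y a u ∈ T} := by
    ext z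
    have : ({a}ᶜ : Set ι).piecewise y z = Function.update y a (z a) := by
      funext i
      by_cases hi : i = a
      · subst hi
        simp
      · rw [Set.piecewise_eq_of_mem _ _ _ (by simpa using hi), Function.update_of_ne hi]
    simp only [Set.mem_preimage, this, Set.mem_ofPred_eq, Function.eval]
  have hU : MeasurableSet {u | Function.update y a u ∈ T} := measurable_update y hT
  beta_reduce
  rw [hpre, (measurePreserving_eval_infinitePi μ a).measure_preimage hU.nullMeasurableSet]
  exact h y

/-- In a sequence of i.i.d. variables, the sequence from time `l` on is independent of what happens
before time `l` and has the same law. -/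
lemma lintegral_infinitePi_shift {α : Type*} [MeasurableSpace α] (μ : Measure α)
    [IsProbabilityMeasure μ] (l : ℕ) {φ : (ℕ → α) → (ℕ → α) → ℝ≥0∞}
    (hφ : Measurable (Function.uncurry φ))
    (hdep : ∀ x x' y, (∀ i < l, x i = x' i) → φ x y = φ x' y) :
    ∫⁻ x, φ x (fun i => x (l + i)) ∂(Measure.infinitePi fun _ => μ) =
      ∫⁻ x, ∫⁻ y, φ x y ∂(Measure.infinitePi fun _ => μ) ∂(Measure.infinitePi fun _ => μ) := by
  have hsh : Measurable fun (x : ℕ → α) (i : ℕ) => x (l + i) :=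
    measurable_pi_lambda _ fun i => measurable_pi_apply _
  have hm := measurable_piecewise_pi (α := fun _ : ℕ => α) (Set.Iio l)
  -- Glue two independent copies at l: the first argument of φ then depends only on the first copy,
  -- the shifted sequence only on the second.
  conv_lhs => rw [← map_piecewise_infinitePi_prod (fun _ => μ) (Set.Iio l)]
  rw [lintegral_map (f := fun x => φ x fun i => x (l + i)) (hφ.comp (measurable_id.prodMk hsh)) hm]
  have hφ' : Measurable fun p : (ℕ → α) × (ℕ → α) => φ p.1 (fun i => p.2 (l + i)) :=
    hφ.comp (measurable_fst.prodMk (hsh.comp measurable_snd))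
  have h1 : ∀ p : (ℕ → α) × (ℕ → α), φ ((Set.Iio l).piecewise p.1 p.2)
      (fun i => (Set.Iio l).piecewise p.1 p.2 (l + i)) = φ p.1 (fun i => p.2 (l + i)) := by
    intro p
    have : (fun i => (Set.Iio l).piecewise p.1 p.2 (l + i)) = fun i => p.2 (l + i) :=
      funext fun i => Set.piecewise_eq_of_notMem _ _ _ (by simp)
    rw [this]
    exact hdep _ _ _ fun i hi => Set.piecewise_eq_of_mem _ _ _ hi
  rw [lintegral_congr h1, lintegral_prod _ hφ'.aemeasurable]
  refine lintegral_congr fun x => ?_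
  conv_rhs => rw [← Measure.map_infinitePi_infinitePi_of_inj (P := fun _ : ℕ => μ)
    (f := fun i => l + i) (add_right_injective l)]
  rw [lintegral_map (f := fun y => φ x y) (hφ.comp measurable_prodMk_left) hsh]

end ProductMeasure

/-! ### Partial sums, absence of ties, and the cycle lemma -/

section Walk

/-- The partial sums of a sequence. -/
def partialSum (x : ℕ → ℝ) (j : ℕ) : ℝ := ∑ i ∈ Finset.range j, x i

lemma partialSum_zero (x : ℕ → ℝ) : partialSum x 0 = 0 := Finset.sum_range_zero _

lemma measurable_partialSum (j : ℕ) : Measurable fun x : ℕ → ℝ => partialSum x j :=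
  Finset.measurable_sum _ fun i _ => measurable_pi_apply i

lemma restart_partialSum (x : ℕ → ℝ) (l : ℕ) :
    restart (partialSum x) l = partialSum fun i => x (l + i) := by
  funext k
  simp [restart, partialSum, Finset.sum_range_add]

lemma partialSum_congr {x x' : ℕ → ℝ} {j : ℕ} (h : ∀ i < j, x i = x' i) :
    partialSum x j = partialSum x' j :=
  Finset.sum_congr rfl fun i hi => h i (Finset.mem_range.1 hi)

lemma partialSum_update (x : ℕ → ℝ) (a : ℕ) (u : ℝ) (j : ℕ) :
    partialSum (Function.update x a u) j = partialSum x j + if a < j then u - x a else 0 := by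
  unfold partialSum
  split_ifs with h
  · rw [Finset.sum_update_of_mem (Finset.mem_range.2 h), Finset.sdiff_singleton_eq_erase,
      ← Finset.add_sum_erase _ x (Finset.mem_range.2 h)]
    ring
  · rw [add_zero]
    refine Finset.sum_congr rfl fun i hi => Function.update_of_ne ?_ _ _
    rintro rfl
    exact h (Finset.mem_range.1 hi)

/-- The sequences whose partial sums stay strictly below the chord from `0` to time `l`. -/
def belowChordSet (l : ℕ) : Set (ℕ → ℝ) :=
  {x | ∀ k : ℕ, 1 ≤ k → k < l → partialSum x k < (k : ℝ) / l * partialSum x l}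

lemma measurableSet_belowChordSet (l : ℕ) : MeasurableSet (belowChordSet l) := by
  simp only [belowChordSet, Set.ofPred_forall]
  exact .iInter fun k => .iInter fun _ => .iInter fun _ =>
    measurableSet_lt (measurable_partialSum k) ((measurable_partialSum l).const_mul _)

variable (μ : Measure ℝ) [IsProbabilityMeasure μ] [NullSingletonClass μ]

lemma infinitePi_partialSum_eq (l : ℕ) (hl : 0 < l) (c : ℝ) :
    Measure.infinitePi (fun _ => μ) {x | partialSum x l = c} = 0 := by
  refine infinitePi_eq_zero_of_update _
    (measurableSet_eq_fun (measurable_partialSum l) measurable_const) 0 fun y =>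
    Set.Subsingleton.measure_zero (fun u hu v hv => ?_) μ
  simp only [Set.mem_ofPred_eq, partialSum_update, if_pos hl] at hu hv
  linarith

/-- For a < b < l, changing the step `x a` by d changes the difference of the two values by d (1 -
(b - a) / l), a nonzero multiple of d, so at most one value of that step produces a tie. Time l is
left out because the value there repeats that at 0. -/
lemma ae_injOn_sub_chord (l : ℕ) : ∀ᵐ x ∂(Measure.infinitePi fun _ => μ),
    Set.InjOn (fun k : ℕ => partialSum x k - (k : ℝ) / l * partialSum x l) (Set.Iio l) := by
  have h : ∀ᵐ x ∂(Measure.infinitePi fun _ => μ), ∀ a b : ℕ, a < b → b < l →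
      partialSum x a - (a : ℝ) / l * partialSum x l ≠
        partialSum x b - (b : ℝ) / l * partialSum x l := by
    refine ae_all_iff.2 fun a => ae_all_iff.2 fun b => ?_
    by_cases hab : a < b
    swap
    · exact ae_of_all _ fun x h => absurd h hab
    by_cases hbl : b < l
    swap
    · exact ae_of_all _ fun x _ h => absurd h hbl
    simp only [hab, hbl, true_implies, ae_iff, not_not]
    refine infinitePi_eq_zero_of_update _ (measurableSet_eq_fun
      ((measurable_partialSum a).sub ((measurable_partialSum l).const_mul _))
      ((measurable_partialSum b).sub ((measurable_partialSum l).const_mul _))) a fun y =>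
      Set.Subsingleton.measure_zero (fun u hu v hv => ?_) μ
    simp only [Set.mem_ofPred_eq, partialSum_update, lt_irrefl, if_false, if_pos hab,
      if_pos (hab.trans hbl)] at hu hv
    have hl : (0 : ℝ) < l := Nat.cast_pos.2 (by omega)
    have h1 : ((b : ℝ) - a) / l < 1 := by
      rw [div_lt_one hl]
      have : (b : ℝ) < l := Nat.cast_lt.2 hbl
      have : (0 : ℝ) ≤ a := Nat.cast_nonneg a
      linarith
    have h2 : (u - v) * (1 - ((b : ℝ) - a) / l) = 0 := by
      rw [sub_div]
      linear_combination hv - hu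
    rcases mul_eq_zero.1 h2 with h | h
    · linarith
    · linarith
  filter_upwards [h] with x hx a ha b hb hab
  rcases lt_trichotomy a b with h1 | h1 | h1
  · exact absurd hab (hx a b h1 hb)
  · exact h1
  · exact absurd hab.symm (hx b a h1 ha)

/-- The cyclic shift by `r` of the first `l` indices. -/
def rotateIndex (l r i : ℕ) : ℕ := if i < l then (i + r) % l else i

/-- An injective reindexing of an i.i.d. sequence preserves its law; this makes all rotations
equally likely. -/
lemma rotateIndex_injective {l : ℕ} (r : ℕ) : Function.Injective (rotateIndex l r) := by
  intro i j h
  unfold rotateIndex at h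
  split_ifs at h with hi hj hj
  · have h2 : i ≡ j [MOD l] := Nat.ModEq.add_right_cancel' r h
    rwa [Nat.ModEq, Nat.mod_eq_of_lt hi, Nat.mod_eq_of_lt hj] at h2
  · have := Nat.mod_lt (i + r) (by omega : 0 < l)
    omega
  · have := Nat.mod_lt (j + r) (by omega : 0 < l)
    omega
  · exact h

lemma partialSum_periodic (x : ℕ → ℝ) (l k : ℕ) :
    partialSum (fun i => x (i % l)) (k + l) =
      partialSum (fun i => x (i % l)) k + partialSum x l := by
  have h0 : partialSum (fun i => x (i % l)) l = partialSum x l :=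
    partialSum_congr fun i hi => by rw [Nat.mod_eq_of_lt hi]
  induction k with
  | zero => rw [zero_add, h0, partialSum_zero, zero_add]
  | succ k ih =>
    rw [show k + 1 + l = k + l + 1 by ring]
    unfold partialSum at ih ⊢
    rw [Finset.sum_range_succ, ih, Finset.sum_range_succ _ k, Nat.add_mod_right]
    ring

lemma partialSum_rotateIndex (x : ℕ → ℝ) (l r : ℕ) {k : ℕ} (hk : k ≤ l) :
    partialSum (fun i => x (rotateIndex l r i)) k =
      partialSum (fun i => x (i % l)) (r + k) - partialSum (fun i => x (i % l)) r := by
  have h1 := congrFun (restart_partialSum (fun i => x (i % l)) r) k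
  rw [restart] at h1
  rw [h1]
  refine partialSum_congr fun i hi => ?_
  rw [rotateIndex, if_pos (by omega), add_comm]

lemma partialSum_rotateIndex_self (x : ℕ → ℝ) (l r : ℕ) :
    partialSum (fun i => x (rotateIndex l r i)) l = partialSum x l := by
  rw [partialSum_rotateIndex x l r le_rfl, partialSum_periodic]
  ring

/-- Subtracting the chord from the periodically continued walk gives an l-periodic function, and
rotation by r moves its origin to r. Staying below the chord thus means that r is its strict maximum
over one period. -/
lemma rotate_mem_belowChordSet_iff (x : ℕ → ℝ) {l r : ℕ} (hr : r < l) :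
    (fun i => x (rotateIndex l r i)) ∈ belowChordSet l ↔
      ∀ m < l, m ≠ r → partialSum x m - (m : ℝ) / l * partialSum x l <
        partialSum x r - (r : ℝ) / l * partialSum x l := by
  have hl : (l : ℝ) ≠ 0 := Nat.cast_ne_zero.2 (by omega)
  have hW : ∀ m ≤ l, partialSum (fun i => x (i % l)) m = partialSum x m := fun m hm =>
    partialSum_congr fun i hi => by rw [Nat.mod_eq_of_lt (by omega)]
  simp only [belowChordSet, Set.mem_ofPred_eq, partialSum_rotateIndex_self]
  constructor
  · intro h m hm hmr
    rcases lt_or_gt_of_ne hmr with hlt | hlt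
    -- A time m < r is reached only after wrapping around one period.
    · have := h (m + l - r) (by omega) (by omega)
      rw [partialSum_rotateIndex x l r (by omega), show r + (m + l - r) = m + l by omega,
        partialSum_periodic, hW m hm.le, hW r hr.le, Nat.cast_sub (by omega), Nat.cast_add,
        sub_div, add_div, div_self hl] at this
      linarith
    · have := h (m - r) (by omega) (by omega)
      rw [partialSum_rotateIndex x l r (by omega), Nat.add_sub_cancel' hlt.le, hW m hm.le,
        hW r hr.le, Nat.cast_sub hlt.le, sub_div] at this
      linarith
  · intro h k hk hkl
    rw [partialSum_rotateIndex x l r hkl.le, hW r hr.le]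
    rcases lt_or_ge (r + k) l with hlt | hlt
    · have := h (r + k) hlt (by omega)
      rw [hW _ hlt.le]
      rw [Nat.cast_add, add_div] at this
      linarith
    · have := h (r + k - l) (by omega) (by omega)
      rw [Nat.cast_sub hlt, Nat.cast_add, sub_div, add_div, div_self hl,
        ← hW (r + k - l) (by omega)] at this
      have h2 := partialSum_periodic x l (r + k - l)
      rw [Nat.sub_add_cancel hlt] at h2
      linarith

/-- The cycle lemma: given the value at time `l`, the walk stays below its chord with probability
`1 / l`. -/
lemma cycle_lemma (l : ℕ) (hl : 0 < l) {B : Set ℝ} (hB : MeasurableSet B) :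
    (l : ℝ≥0∞) * Measure.infinitePi (fun _ => μ) (belowChordSet l ∩ {x | partialSum x l ∈ B}) =
      Measure.infinitePi (fun _ => μ) {x | partialSum x l ∈ B} := by
  set A : Set (ℕ → ℝ) := belowChordSet l ∩ {x | partialSum x l ∈ B} with hA
  have hBm : MeasurableSet {x : ℕ → ℝ | partialSum x l ∈ B} := measurable_partialSum l hB
  have hAm : MeasurableSet A := (measurableSet_belowChordSet l).inter hBm
  have hrot : ∀ r, Measurable fun (x : ℕ → ℝ) i => x (rotateIndex l r i) := fun r =>
    measurable_pi_lambda _ fun i => measurable_pi_apply _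
  have h1 : ∀ r, ∫⁻ x, A.indicator 1 (fun i => x (rotateIndex l r i))
      ∂(Measure.infinitePi fun _ => μ) = Measure.infinitePi (fun _ => μ) A := fun r => by
    rw [← lintegral_map (measurable_one.indicator hAm) (hrot r),
      Measure.map_infinitePi_infinitePi_of_inj (P := fun _ : ℕ => μ) (rotateIndex_injective r),
      lintegral_indicator_one hAm]
  rw [← lintegral_indicator_one hBm]
  calc (l : ℝ≥0∞) * Measure.infinitePi (fun _ => μ) A
      = ∑ r ∈ Finset.range l, ∫⁻ x, A.indicator 1 (fun i => x (rotateIndex l r i))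
          ∂(Measure.infinitePi fun _ => μ) := by simp [h1]
    _ = ∫⁻ x, ∑ r ∈ Finset.range l, A.indicator 1 (fun i => x (rotateIndex l r i))
          ∂(Measure.infinitePi fun _ => μ) :=
        (lintegral_finsetSum _ fun r _ => (measurable_one.indicator hAm).comp (hrot r)).symm
    _ = _ := by
        -- Without ties the maximum over one period is unique, so exactly one rotation contributes;
        -- S_l, hence the event S_l ∈ B, is the same for all rotations.
        refine lintegral_congr_ae ?_
        filter_upwards [ae_injOn_sub_chord μ l] with x hx
        by_cases hxB : partialSum x l ∈ B
        · have hmem : ∀ r < l, ((fun i => x (rotateIndex l r i)) ∈ A ↔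
              ∀ m < l, m ≠ r → partialSum x m - (m : ℝ) / l * partialSum x l <
                partialSum x r - (r : ℝ) / l * partialSum x l) := fun r hr => by
            rw [← rotate_mem_belowChordSet_iff x hr, hA, Set.mem_inter_iff, Set.mem_ofPred_eq,
              partialSum_rotateIndex_self]
            exact and_iff_left hxB
          obtain ⟨r, hr, hmax⟩ := (Finset.range l).exists_max_image
            (fun k : ℕ => partialSum x k - (k : ℝ) / l * partialSum x l) ⟨0, by simp [hl]⟩
          rw [Finset.mem_range] at hr
          have hrmax : ∀ m < l, m ≠ r → partialSum x m - (m : ℝ) / l * partialSum x l <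
              partialSum x r - (r : ℝ) / l * partialSum x l := fun m hm hmr =>
            lt_of_le_of_ne (hmax m (Finset.mem_range.2 hm)) fun heq => hmr (hx hm hr heq)
          rw [Finset.sum_eq_single r, Set.indicator_of_mem ((hmem r hr).2 hrmax),
            Set.indicator_of_mem (s := {x : ℕ → ℝ | partialSum x l ∈ B}) (a := x) hxB]
          · rfl
          · intro m hm hmr
            rw [Finset.mem_range] at hm
            refine Set.indicator_of_notMem (fun h => ?_) _
            exact lt_asymm (hrmax m hm hmr) ((hmem m hm).1 h r hr hmr.symm)
          · simp [hr]
        · rw [Set.indicator_of_notMem (s := {x : ℕ → ℝ | partialSum x l ∈ B}) (a := x) hxB]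
          refine Finset.sum_eq_zero fun r _ => Set.indicator_of_notMem (fun h => hxB ?_) _
          have := h.2
          rwa [Set.mem_ofPred_eq, partialSum_rotateIndex_self] at this

end Walk

/-! ### Measurability of faces and segments -/

section Measurability

lemma measurable_of_countable_cases {α β ι : Type*} [MeasurableSpace α] [MeasurableSpace β]
    [Countable ι] {f : α → ι} (hf : ∀ i, MeasurableSet {a | f a = i}) {Ψ : ι → α → β}
    (hΨ : ∀ i, Measurable (Ψ i)) : Measurable fun a => Ψ (f a) a := by
  intro T hT
  have : (fun a => Ψ (f a) a) ⁻¹' T = ⋃ i, {a | f a = i} ∩ Ψ i ⁻¹' T := by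
    ext a
    simp
  rw [this]
  exact .iUnion fun i => (hf i).inter (hΨ i hT)

lemma measurableSet_sigma_iff {ι : Type*} {α : ι → Type*} [∀ i, MeasurableSpace (α i)]
    {T : Set (Σ i, α i)} : MeasurableSet T ↔ ∀ i, MeasurableSet (Sigma.mk i ⁻¹' T) :=
  MeasurableSpace.measurableSet_iInf

lemma measurable_initialSegment {α : Type*} [MeasurableSpace α] {φ : α → ℕ → ℝ}
    (hφ : ∀ k, Measurable fun a => φ a k) (j : ℕ+) :
    Measurable fun a => initialSegment (φ a) j := by
  have h : Measurable fun (a : α) (k : Fin (j : ℕ)) => φ a ((k : ℕ) + 1) :=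
    measurable_pi_lambda _ fun k => hφ _
  exact fun T hT => h (measurableSet_sigma_iff.1 hT j)

/-- The final value of a path segment. -/
def PathSegment.last (z : PathSegment) : ℝ :=
  z.2 ⟨(z.1 : ℕ) - 1, Nat.sub_lt z.1.pos one_pos⟩

lemma measurable_length_last : Measurable fun z : PathSegment => (z.1, z.last) := by
  intro T hT
  refine measurableSet_sigma_iff.2 fun j => ?_
  have : Measurable fun y : Fin (j : ℕ) → ℝ => (j, y ⟨(j : ℕ) - 1, Nat.sub_lt j.pos one_pos⟩) :=
    measurable_const.prodMk (measurable_pi_apply _)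
  exact this hT

/-- The slope of the chord of a path segment. -/
noncomputable def PathSegment.slope (z : PathSegment) : EReal := ((z.last / ((z.1 : ℕ) : ℝ) : ℝ) : EReal)

lemma measurable_slope : Measurable PathSegment.slope := by
  have h : Measurable fun p : ℕ+ × ℝ => ((p.2 / ((p.1 : ℕ) : ℝ) : ℝ) : EReal) :=
    measurable_coe_real_ereal.comp (measurable_snd.div
      ((measurable_from_top (f := fun j : ℕ+ => ((j : ℕ) : ℝ))).comp measurable_fst))
  exact h.comp measurable_length_last

lemma last_initialSegment (s : ℕ → ℝ) (j : ℕ+) : (initialSegment s j).last = s j := by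
  simp only [PathSegment.last, initialSegment]
  rw [Nat.sub_add_cancel (show 1 ≤ (j : ℕ) from j.pos)]

lemma slope_initialSegment (s : ℕ → ℝ) (j : ℕ+) :
    (initialSegment s j).slope = ((s j / ((j : ℕ) : ℝ) : ℝ) : EReal) := by
  rw [PathSegment.slope, last_initialSegment]
  rfl

lemma measurableSet_mem_meetSet (n j : ℕ) :
    MeasurableSet {x : ℕ → ℝ | j ∈ meetSet (partialSum x) n} := by
  simp only [mem_meetSet_iff, Set.ofPred_and, Set.ofPred_forall]
  refine (MeasurableSet.const _).inter (.iInter fun i => .iInter fun k => .iInter fun _ =>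
    .iInter fun _ => .iInter fun _ => measurableSet_le ?_ ?_)
  · exact ((measurable_partialSum k).sub (measurable_partialSum j)).mul_const _
  · exact ((measurable_partialSum j).sub (measurable_partialSum i)).mul_const _

/-- The times at which the path meets its concave majorant, as a finite set. -/
noncomputable def meetFinset (s : ℕ → ℝ) (n : ℕ) : Finset ℕ := (meetSet_finite s n).toFinset

/-- The set of meeting times takes countably many values; once it is fixed, all face data are
measurable functions of the steps. -/
lemma measurable_meetFinset_cases {β : Type*} [MeasurableSpace β] (n : ℕ)
    {Ψ : Finset ℕ → (ℕ → ℝ) → β} (hΨ : ∀ m, Measurable (Ψ m)) :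
    Measurable fun x => Ψ (meetFinset (partialSum x) n) x := by
  refine measurable_of_countable_cases (fun m => ?_) hΨ
  have : {x : ℕ → ℝ | meetFinset (partialSum x) n = m} =
      ⋂ j : ℕ, {x | j ∈ meetSet (partialSum x) n ↔ j ∈ m} := by
    ext x
    simp [meetFinset, Finset.ext_iff]
  rw [this]
  exact .iInter fun j => (measurableSet_mem_meetSet n j).iff (.const _)

lemma numFaces_eq_card (s : ℕ → ℝ) (n : ℕ) : numFaces s n = (meetFinset s n).card - 1 := by
  rw [numFaces, Set.ncard_eq_toFinset_card _ (meetSet_finite s n), meetFinset]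

/-- The `i`-th segment of a path between the successive times in a finite set. -/
noncomputable def segmentBetween (m : Finset ℕ) (s : ℕ → ℝ) (i : ℕ) : PathSegment :=
  initialSegment (fun k => s (Nat.nth (· ∈ m) i + k) - s (Nat.nth (· ∈ m) i))
    (Nat.nth (· ∈ m) (i + 1) - Nat.nth (· ∈ m) i).toPNat'

lemma faceSegment_eq_segmentBetween (s : ℕ → ℝ) (n i : ℕ) :
    faceSegment s n i = segmentBetween (meetFinset s n) s i := by
  have h : (fun j => j ∈ meetFinset s n) = fun j => j ∈ meetSet s n :=
    funext fun j => by simp [meetFinset]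
  simp only [segmentBetween, h]
  rfl

lemma measurable_segmentBetween (m : Finset ℕ) (i : ℕ) :
    Measurable fun x => segmentBetween m (partialSum x) i :=
  measurable_initialSegment
    (fun _ => (measurable_partialSum _).sub (measurable_partialSum _)) _

lemma measurable_numFaces (n : ℕ) : Measurable fun x => numFaces (partialSum x) n := by
  simp only [numFaces_eq_card]
  exact measurable_meetFinset_cases n (Ψ := fun m _ => m.card - 1) fun m => measurable_const

lemma measurable_prod_faceSegment (n : ℕ) {g : PathSegment → ℝ≥0∞} (hg : Measurable g) :
    Measurable fun x => ∏ i ∈ Finset.range (numFaces (partialSum x) n),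
      g (faceSegment (partialSum x) n i) := by
  simp only [numFaces_eq_card, faceSegment_eq_segmentBetween]
  exact measurable_meetFinset_cases n (Ψ := fun m x => ∏ i ∈ Finset.range (m.card - 1),
    g (segmentBetween m (partialSum x) i)) fun m =>
    Finset.measurable_prod _ fun i _ => hg.comp (measurable_segmentBetween m i)

lemma measurable_segmentProcess (n : ℕ) :
    Measurable fun x => segmentProcess (partialSum x) n := by
  refine Measure.measurable_of_measurable_coe _ fun B hB => ?_
  simp only [segmentProcess, Measure.finsetSum_apply, numFaces_eq_card,
    faceSegment_eq_segmentBetween]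
  exact measurable_meetFinset_cases n (Ψ := fun m x => ∑ i ∈ Finset.range (m.card - 1),
    Measure.dirac (segmentBetween m (partialSum x) i) B) fun m =>
    Finset.measurable_sum _ fun i _ =>
      (Measure.measurable_coe hB).comp (Measure.measurable_dirac.comp (measurable_segmentBetween m i))

lemma faceProcess_eq_map (s : ℕ → ℝ) (n : ℕ) :
    faceProcess s n = (segmentProcess s n).map fun z => (z.1, z.last) := by
  ext B hB
  rw [Measure.map_apply measurable_length_last hB]
  simp only [segmentProcess, faceProcess, Measure.finsetSum_apply]
  refine Finset.sum_congr rfl fun i hi => ?_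
  rw [Measure.dirac_apply' _ hB, Measure.dirac_apply' _ (measurable_length_last hB)]
  have hl := coe_faceLength s n i (Finset.mem_range.1 hi)
  have hlt := meetTime_lt_meetTime_succ s n i (Finset.mem_range.1 hi)
  have h : (faceSegment s n i).last = faceIncrement s n i := by
    rw [faceSegment, last_initialSegment, hl, Nat.add_sub_cancel' hlt.le, faceIncrement]
  have h2 : ((faceSegment s n i).1, (faceSegment s n i).last) =
      (faceLength s n i, faceIncrement s n i) := by
    rw [h]
    rfl
  have h3 : faceSegment s n i ∈ (fun z : PathSegment => (z.1, z.last)) ⁻¹' B ↔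
      (faceLength s n i, faceIncrement s n i) ∈ B := by
    rw [← h2]
    rfl
  by_cases hB' : (faceLength s n i, faceIncrement s n i) ∈ B
  · rw [Set.indicator_of_mem hB', Set.indicator_of_mem (h3.2 hB')]
    rfl
  · rw [Set.indicator_of_notMem hB', Set.indicator_of_notMem (fun h => hB' (h3.1 h))]

end Measurability

/-! ### Recursion over the first face -/

section FaceRecursion

/-- The sequences whose partial sums up to time `n` stay below the line of slope `a`. -/
def slopeLESet (n : ℕ) (a : EReal) : Set (ℕ → ℝ) :=
  {x | ∀ k : ℕ, 1 ≤ k → k ≤ n → ((partialSum x k / (k : ℝ) : ℝ) : EReal) ≤ a}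

/-- Extended-real thresholds allow the unconstrained walk to be the case a = ⊤ of the recursion. -/
lemma slopeLESet_top (n : ℕ) : slopeLESet n ⊤ = Set.univ :=
  Set.eq_univ_of_forall fun _ _ _ _ => le_top

/-- The product of `g` over the path segments of the faces, if there are `f` faces. -/
noncomputable def faceWeight (g : PathSegment → ℝ≥0∞) (f n : ℕ) (x : ℕ → ℝ) : ℝ≥0∞ :=
  if numFaces (partialSum x) n = f then
    ∏ i ∈ Finset.range (numFaces (partialSum x) n), g (faceSegment (partialSum x) n i) else 0

lemma measurable_faceWeight {g : PathSegment → ℝ≥0∞} (hg : Measurable g) (f n : ℕ) :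
    Measurable (faceWeight g f n) :=
  Measurable.ite (measurable_numFaces n (measurableSet_singleton f))
    (measurable_prod_faceSegment n hg) measurable_const

lemma measurableSet_slopeLE {α : Type*} [MeasurableSpace α] {b : α → EReal} (hb : Measurable b)
    (n : ℕ) : MeasurableSet {p : α × (ℕ → ℝ) | p.2 ∈ slopeLESet n (b p.1)} := by
  have : {p : α × (ℕ → ℝ) | p.2 ∈ slopeLESet n (b p.1)} = ⋂ k : ℕ, ⋂ _ : 1 ≤ k, ⋂ _ : k ≤ n,
      {p : α × (ℕ → ℝ) | ((partialSum p.2 k / (k : ℝ) : ℝ) : EReal) ≤ b p.1} := by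
    ext p
    simp only [slopeLESet, Set.mem_iInter, Set.mem_ofPred_eq]
  rw [this]
  exact .iInter fun k => .iInter fun _ => .iInter fun _ => measurableSet_le
    (measurable_coe_real_ereal.comp
      (((measurable_partialSum k).comp measurable_snd).div_const _)) (hb.comp measurable_fst)

lemma measurableSet_slopeLESet (n : ℕ) (a : EReal) : MeasurableSet (slopeLESet n a) :=
  measurable_prodMk_left (x := ()) (measurableSet_slopeLE (b := fun _ : Unit => a)
    measurable_const n)

/-- Splits the event into a condition on the first l steps and one on the later steps, linked only
through the slope of the first segment. -/
lemma isFirstFace_partialSum_iff (x : ℕ → ℝ) (l : ℕ+) (m : ℕ) :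
    IsFirstFace (partialSum x) (l + m) l ↔ x ∈ belowChordSet l ∧
      (fun i => x (l + i)) ∈ slopeLESet m (initialSegment (partialSum x) l).slope := by
  have h : ∀ k : ℕ, 1 ≤ k →
      (((partialSum (fun i => x (l + i)) k / (k : ℝ) : ℝ) : EReal) ≤
        (initialSegment (partialSum x) l).slope ↔
      partialSum x (l + k) - partialSum x l ≤ k * (partialSum x l / ((l : ℕ) : ℝ))) := by
    intro k hk
    rw [slope_initialSegment, EReal.coe_le_coe_iff, div_le_iff₀ (Nat.cast_pos.2 hk), mul_comm,
      ← restart_partialSum]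
    rfl
  constructor
  · exact fun hF => ⟨hF.below, fun k hk hkm => (h k hk).2 (hF.after k hk (by omega))⟩
  · exact fun ⟨h1, h2⟩ => ⟨l.pos, by omega, h1, fun k hk hkm => (h k hk).1 (h2 k hk (by omega))⟩

/-- The first face maximises S_k / k, so it alone decides the slope constraint. -/
lemma IsFirstFace.mem_slopeLESet_iff {x : ℕ → ℝ} {n : ℕ} {l : ℕ+}
    (h : IsFirstFace (partialSum x) n l) (a : EReal) :
    x ∈ slopeLESet n a ↔ (initialSegment (partialSum x) l).slope ≤ a := by
  rw [slope_initialSegment]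
  refine ⟨fun hx => hx l l.pos h.le, fun ha k hk hkn => le_trans ?_ ha⟩
  have h1 := h.le_line (partialSum_zero x) hkn
  have hl : (0 : ℝ) < (l : ℕ) := Nat.cast_pos.2 l.pos
  rw [EReal.coe_le_coe_iff, div_le_iff₀ (Nat.cast_pos.2 hk)]
  refine h1.trans (le_of_eq ?_)
  field_simp
  ring

/-- The contribution of a first face of length `l` to the weight of a path with `f + 1` faces and
length `l + m`, in terms of the path `x` up to time `l` and the path `y` after time `l`. -/
noncomputable def firstFaceWeight (g : PathSegment → ℝ≥0∞) (f : ℕ) (a : EReal) (l : ℕ+) (m : ℕ)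
    (x y : ℕ → ℝ) : ℝ≥0∞ :=
  (belowChordSet l ∩ {x | (initialSegment (partialSum x) l).slope ≤ a}).indicator
    (fun x => g (initialSegment (partialSum x) l) *
      (slopeLESet m (initialSegment (partialSum x) l).slope).indicator (faceWeight g f m) y) x

lemma measurable_initialSegment_partialSum (l : ℕ+) :
    Measurable fun x => initialSegment (partialSum x) l :=
  measurable_initialSegment measurable_partialSum l

lemma measurableSet_below_slope (a : EReal) (l : ℕ+) : MeasurableSet
    (belowChordSet l ∩ {x | (initialSegment (partialSum x) l).slope ≤ a}) :=
  (measurableSet_belowChordSet l).inter (measurableSet_le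
    (measurable_slope.comp (measurable_initialSegment_partialSum l)) measurable_const)

lemma measurable_firstFaceWeight {g : PathSegment → ℝ≥0∞} (hg : Measurable g) (f : ℕ) (a : EReal)
    (l : ℕ+) (m : ℕ) : Measurable (Function.uncurry (firstFaceWeight g f a l m)) := by
  have hi := measurable_initialSegment_partialSum l
  have h1 : Measurable fun p : (ℕ → ℝ) × (ℕ → ℝ) => g (initialSegment (partialSum p.1) l) *
      {p : (ℕ → ℝ) × (ℕ → ℝ) |
        p.2 ∈ slopeLESet m (initialSegment (partialSum p.1) l).slope}.indicator
        (fun p => faceWeight g f m p.2) p :=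
    (hg.comp (hi.comp measurable_fst)).mul
      (((measurable_faceWeight hg f m).comp measurable_snd).indicator
        (measurableSet_slopeLE (measurable_slope.comp hi) m))
  exact h1.indicator (measurable_fst (measurableSet_below_slope a l))

lemma firstFaceWeight_congr (g : PathSegment → ℝ≥0∞) (f : ℕ) (a : EReal) (l : ℕ+) (m : ℕ)
    (x x' y : ℕ → ℝ) (h : ∀ i < (l : ℕ), x i = x' i) :
    firstFaceWeight g f a l m x y = firstFaceWeight g f a l m x' y := by
  have hW : ∀ k ≤ (l : ℕ), partialSum x k = partialSum x' k := fun k hk =>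
    partialSum_congr fun i hi => h i (by omega)
  have h1 : initialSegment (partialSum x) l = initialSegment (partialSum x') l := by
    unfold initialSegment
    congr 1
    funext k
    exact hW _ (by omega)
  have h2 : x ∈ belowChordSet l ↔ x' ∈ belowChordSet l := by
    refine forall_congr' fun k => forall_congr' fun _ => forall_congr' fun hk => ?_
    rw [hW k hk.le, hW l le_rfl]
  have h3 : x ∈ belowChordSet l ∩ {x | (initialSegment (partialSum x) l).slope ≤ a} ↔
      x' ∈ belowChordSet l ∩ {x | (initialSegment (partialSum x) l).slope ≤ a} := by
    rw [Set.mem_inter_iff, Set.mem_inter_iff, Set.mem_ofPred_eq, Set.mem_ofPred_eq, h1, h2]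
  unfold firstFaceWeight
  by_cases hx : x ∈ belowChordSet l ∩ {x | (initialSegment (partialSum x) l).slope ≤ a}
  · rw [Set.indicator_of_mem hx, Set.indicator_of_mem (h3.1 hx), h1]
  · rw [Set.indicator_of_notMem hx, Set.indicator_of_notMem (fun h => hx (h3.2 h))]

lemma numFaces_eq_zero_iff (s : ℕ → ℝ) (n : ℕ) : numFaces s n = 0 ↔ n = 0 := by
  constructor
  · intro h
    have h1 := meetTime_numFaces s n
    rw [h, meetTime_zero] at h1
    exact h1.symm
  · rintro rfl
    have : meetSet s 0 = {0} :=
      Set.Subset.antisymm (fun j hj => Nat.le_zero.1 hj.1) (by simp [zero_mem_meetSet])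
    simp [numFaces, this]

/-- Only the length of the actual first face contributes to the sum, and there the weight factors
into its segment and the restarted path. -/
lemma indicator_faceWeight_succ (g : PathSegment → ℝ≥0∞) (f n : ℕ) (a : EReal) (x : ℕ → ℝ) :
    (slopeLESet n a).indicator (faceWeight g (f + 1) n) x =
      ∑' l : ℕ+, if (l : ℕ) ≤ n then
        firstFaceWeight g f a l (n - l) x (fun i => x (l + i)) else 0 := by
  rcases Nat.eq_zero_or_pos n with rfl | hn
  · simp [Set.indicator, faceWeight, (numFaces_eq_zero_iff (partialSum x) 0).2 rfl]
  obtain ⟨l, hl⟩ := exists_isFirstFace (partialSum x) hn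
  lift l to ℕ+ using hl.pos
  obtain ⟨m, rfl⟩ := Nat.exists_eq_add_of_le hl.le
  rw [tsum_eq_single l]
  · rw [if_pos hl.le, Nat.add_sub_cancel_left]
    obtain ⟨h1, h2⟩ := (isFirstFace_partialSum_iff x l m).1 hl
    have h3 := hl.mem_slopeLESet_iff a
    have h4 : faceWeight g (f + 1) (l + m) x =
        g (initialSegment (partialSum x) l) * faceWeight g f m (fun i => x (l + i)) := by
      have h5 := hl.prod_faceSegment (partialSum_zero x) g
      have h6 := hl.numFaces_eq (partialSum_zero x)
      rw [Nat.add_sub_cancel_left, restart_partialSum] at h5 h6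
      rw [faceWeight, faceWeight, h5, h6, mul_ite, mul_zero]
      simp only [Nat.add_right_cancel_iff]
    by_cases ha : (initialSegment (partialSum x) l).slope ≤ a
    · rw [Set.indicator_of_mem (h3.2 ha), firstFaceWeight,
        Set.indicator_of_mem (show x ∈ belowChordSet l ∩ _ from ⟨h1, ha⟩),
        Set.indicator_of_mem h2, h4]
    · rw [Set.indicator_of_notMem (fun h => ha (h3.1 h)), firstFaceWeight,
        Set.indicator_of_notMem (fun h => ha h.2)]
  · intro l' hl'
    split_ifs with hle
    swap
    · rfl
    have hnf : ¬ IsFirstFace (partialSum x) (l + m) l' := fun h =>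
      hl' (PNat.coe_injective (h.unique hl))
    obtain ⟨m', hm'⟩ := Nat.exists_eq_add_of_le hle
    rw [hm', isFirstFace_partialSum_iff] at hnf
    rw [hm', Nat.add_sub_cancel_left, firstFaceWeight]
    by_cases h1 : x ∈ belowChordSet l'
    · by_cases ha : (initialSegment (partialSum x) l').slope ≤ a
      · rw [Set.indicator_of_mem (show x ∈ belowChordSet l' ∩ _ from ⟨h1, ha⟩),
          Set.indicator_of_notMem (fun h => hnf ⟨h1, h⟩), mul_zero]
      · rw [Set.indicator_of_notMem (fun h => ha h.2)]
    · rw [Set.indicator_of_notMem (fun h => h1 h.1)]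

variable (μ : Measure ℝ) [IsProbabilityMeasure μ]

/-- The intensity measure of the path segments, in terms of the law of a single step. -/
noncomputable def stepSegmentIntensity (q : ℝ≥0∞) : Measure PathSegment :=
  Measure.sum fun l : ℕ+ => q ^ (l : ℕ) •
    ((Measure.infinitePi fun _ : ℕ => μ).restrict (belowChordSet l)).map
      fun x => initialSegment (partialSum x) l

/-- The generating function of the weights of the paths with `f` faces of slope at most `a`. -/
noncomputable def faceGenFun (q : ℝ≥0∞) (g : PathSegment → ℝ≥0∞) (f : ℕ) (a : EReal) : ℝ≥0∞ :=
  ∑' n : ℕ, q ^ n * ∫⁻ x, (slopeLESet n a).indicator (faceWeight g f n) x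
    ∂(Measure.infinitePi fun _ : ℕ => μ)

lemma faceGenFun_zero (q : ℝ≥0∞) (g : PathSegment → ℝ≥0∞) (a : EReal) :
    faceGenFun μ q g 0 a = 1 := by
  have h0 : ∀ x, x ∈ slopeLESet 0 a := fun x k hk hk0 => by omega
  rw [faceGenFun, tsum_eq_single 0]
  · simp [faceWeight, (numFaces_eq_zero_iff _ 0).2 rfl, Set.indicator, h0]
  · intro n hn
    have : ∀ x, faceWeight g 0 n x = 0 := fun x => if_neg fun h =>
      hn ((numFaces_eq_zero_iff _ n).1 h)
    simp [Set.indicator, this]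

lemma measurable_lintegral_slopeLESet {g : PathSegment → ℝ≥0∞} (hg : Measurable g) (f n : ℕ) :
    Measurable fun a : EReal => ∫⁻ x, (slopeLESet n a).indicator (faceWeight g f n) x
      ∂(Measure.infinitePi fun _ : ℕ => μ) := by
  have h : Measurable fun p : EReal × (ℕ → ℝ) =>
      {p : EReal × (ℕ → ℝ) | p.2 ∈ slopeLESet n p.1}.indicator
        (fun p => faceWeight g f n p.2) p :=
    ((measurable_faceWeight hg f n).comp measurable_snd).indicator
      (measurableSet_slopeLE measurable_id n)
  exact h.lintegral_prod_right'

/-- Integrate out the path after the first face, independent of the past: the slope of that face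
becomes the new threshold. -/
lemma faceGenFun_succ (q : ℝ≥0∞) {g : PathSegment → ℝ≥0∞} (hg : Measurable g) (f : ℕ)
    (a : EReal) : faceGenFun μ q g (f + 1) a =
      ∫⁻ z in {z | z.slope ≤ a}, faceGenFun μ q g f z.slope
        ∂((stepSegmentIntensity μ q).withDensity g) := by
  set M := Measure.infinitePi fun _ : ℕ => μ with hM
  have hsl : ∀ l : ℕ+, Measurable fun (x : ℕ → ℝ) (i : ℕ) => x (l + i) := fun l =>
    measurable_pi_lambda _ fun i => measurable_pi_apply _
  have hT : ∀ (l : ℕ+) (m : ℕ), Measurable fun x : ℕ → ℝ =>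
      firstFaceWeight g f a l m x fun i => x (l + i) := fun l m =>
    (measurable_firstFaceWeight hg f a l m).comp (measurable_id.prodMk (hsl l))
  have hG : Measurable fun z : PathSegment => faceGenFun μ q g f z.slope := by
    unfold faceGenFun
    exact Measurable.tsum fun n =>
      ((measurable_lintegral_slopeLESet μ hg f n).comp measurable_slope).const_mul _
  have hsm : MeasurableSet {z : PathSegment | z.slope ≤ a} :=
    measurableSet_le measurable_slope measurable_const
  have h1 : ∀ (l : ℕ+) (m : ℕ), ∫⁻ x, firstFaceWeight g f a l m x (fun i => x (l + i)) ∂M =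
      ∫⁻ x in belowChordSet l, {z : PathSegment | z.slope ≤ a}.indicator (fun z => g z *
        ∫⁻ y, (slopeLESet m z.slope).indicator (faceWeight g f m) y ∂M)
          (initialSegment (partialSum x) l) ∂M := by
    intro l m
    rw [lintegral_infinitePi_shift μ l (measurable_firstFaceWeight hg f a l m)
      (firstFaceWeight_congr g f a l m), ← lintegral_indicator (measurableSet_belowChordSet l)]
    refine lintegral_congr fun x => ?_
    by_cases hb : x ∈ belowChordSet l
    · rw [Set.indicator_of_mem hb]
      by_cases ha : (initialSegment (partialSum x) l).slope ≤ a
      · rw [Set.indicator_of_mem (show initialSegment (partialSum x) l ∈ _ from ha),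
          ← lintegral_const_mul _ ((measurable_faceWeight hg f m).indicator
            (measurableSet_slopeLESet m _))]
        refine lintegral_congr fun y => ?_
        rw [firstFaceWeight, Set.indicator_of_mem (show x ∈ belowChordSet l ∩ _ from ⟨hb, ha⟩)]
      · rw [Set.indicator_of_notMem (show initialSegment (partialSum x) l ∉ _ from ha)]
        simp only [firstFaceWeight]
        rw [lintegral_congr fun y => Set.indicator_of_notMem (fun h => ha h.2) _, lintegral_zero]
    · rw [Set.indicator_of_notMem hb]
      simp only [firstFaceWeight]
      rw [lintegral_congr fun y => Set.indicator_of_notMem (fun h => hb h.1) _, lintegral_zero]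
  -- Only n = l + m contributes, q^n factors as q^l q^m, and the sum over m rebuilds the generating
  -- function with f faces.
  have h2 : ∀ l : ℕ+, (∑' n : ℕ, q ^ n * ∫⁻ x, (if (l : ℕ) ≤ n then
        firstFaceWeight g f a l (n - l) x (fun i => x (l + i)) else 0) ∂M) =
      q ^ (l : ℕ) * ∫⁻ x in belowChordSet l, {z : PathSegment | z.slope ≤ a}.indicator
        (fun z => g z * faceGenFun μ q g f z.slope) (initialSegment (partialSum x) l) ∂M := by
    intro l
    have hsupp : Function.support (fun n : ℕ => q ^ n * ∫⁻ x, (if (l : ℕ) ≤ n then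
        firstFaceWeight g f a l (n - l) x (fun i => x (l + i)) else 0) ∂M) ⊆
        Set.range fun m : ℕ => (l : ℕ) + m := by
      intro n hn
      by_cases hln : (l : ℕ) ≤ n
      · exact ⟨n - l, Nat.add_sub_cancel' hln⟩
      · simp [hln] at hn
    rw [← (add_right_injective (l : ℕ)).tsum_eq hsupp]
    simp only [Nat.le_add_right, if_true, Nat.add_sub_cancel_left, h1, pow_add, mul_assoc]
    rw [ENNReal.tsum_mul_left]
    congr 1
    have hm : ∀ m : ℕ, Measurable fun x : ℕ → ℝ => {z : PathSegment | z.slope ≤ a}.indicator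
        (fun z => g z * ∫⁻ y, (slopeLESet m z.slope).indicator (faceWeight g f m) y ∂M)
          (initialSegment (partialSum x) l) := fun m =>
      ((hg.mul ((measurable_lintegral_slopeLESet μ hg f m).comp measurable_slope)).indicator
        hsm).comp (measurable_initialSegment_partialSum l)
    simp_rw [← lintegral_const_mul _ (hm _)]
    rw [← lintegral_tsum fun m => ((hm m).const_mul _).aemeasurable]
    refine lintegral_congr fun x => ?_
    by_cases ha : (initialSegment (partialSum x) l).slope ≤ a
    · simp only [Set.indicator, Set.mem_ofPred_eq, ha, if_true, faceGenFun]
      rw [← ENNReal.tsum_mul_left]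
      exact tsum_congr fun m => by ring
    · simp [Set.indicator, ha]
  have h3 : ∀ n, ∫⁻ x, (slopeLESet n a).indicator (faceWeight g (f + 1) n) x ∂M =
      ∑' l : ℕ+, ∫⁻ x, (if (l : ℕ) ≤ n then
        firstFaceWeight g f a l (n - l) x (fun i => x (l + i)) else 0) ∂M := by
    intro n
    rw [lintegral_congr (indicator_faceWeight_succ g f n a), lintegral_tsum]
    intro l
    split_ifs
    · exact (hT l _).aemeasurable
    · exact aemeasurable_const
  have hF : Measurable fun z : PathSegment =>
      {z : PathSegment | z.slope ≤ a}.indicator (fun z => g z * faceGenFun μ q g f z.slope) z :=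
    (hg.mul hG).indicator hsm
  rw [setLIntegral_withDensity_eq_setLIntegral_mul _ hg hG hsm, ← lintegral_indicator hsm,
    stepSegmentIntensity, lintegral_sum_measure, faceGenFun]
  simp only [← hM, h3, ← ENNReal.tsum_mul_left]
  rw [ENNReal.tsum_comm]
  refine tsum_congr fun l => ?_
  rw [h2 l, lintegral_smul_measure, smul_eq_mul]
  exact congrArg _ (lintegral_map hF (measurable_initialSegment_partialSum l)).symm

end FaceRecursion

/-! ### Finiteness and atomless slopes of the intensity; solution of the recursion -/

section Intensity

variable (μ : Measure ℝ) [IsProbabilityMeasure μ]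

lemma isFiniteMeasure_stepSegmentIntensity {q : ℝ≥0∞} (hq : q < 1) :
    IsFiniteMeasure (stepSegmentIntensity μ q) := by
  refine ⟨?_⟩
  rw [stepSegmentIntensity, Measure.sum_apply _ .univ]
  calc ∑' l : ℕ+, (q ^ (l : ℕ) • ((Measure.infinitePi fun _ : ℕ => μ).restrict
        (belowChordSet l)).map fun x => initialSegment (partialSum x) l) Set.univ
      ≤ ∑' l : ℕ+, q ^ (l : ℕ) := by
        refine ENNReal.tsum_le_tsum fun l => ?_
        rw [Measure.smul_apply, smul_eq_mul,
          Measure.map_apply (measurable_initialSegment_partialSum l) .univ]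
        exact mul_le_of_le_one_right (by simp)
          ((Measure.restrict_apply_le _ _).trans prob_le_one)
    _ ≤ ∑' n : ℕ, q ^ n := ENNReal.tsum_comp_le_tsum_of_injective PNat.coe_injective _
    _ = (1 - q)⁻¹ := ENNReal.tsum_geometric q
    _ < ⊤ := by simp [hq]

lemma stepSegmentIntensity_slope_eq [NullSingletonClass μ] (q : ℝ≥0∞) (a : EReal) :
    stepSegmentIntensity μ q {z | z.slope = a} = 0 := by
  have hm : MeasurableSet {z : PathSegment | z.slope = a} :=
    measurable_slope (measurableSet_singleton a)
  rw [stepSegmentIntensity, Measure.sum_apply _ hm, ENNReal.tsum_eq_zero]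
  intro l
  rw [Measure.smul_apply, Measure.map_apply (measurable_initialSegment_partialSum l) hm]
  refine smul_eq_zero_of_right _ (nonpos_iff_eq_zero.1 ((Measure.restrict_apply_le _ _).trans ?_))
  -- Slope a forces S_l = a l, a null event. For infinite a the set is empty, so the default value
  -- of `toReal` is harmless.
  rw [← infinitePi_partialSum_eq μ l l.pos (a.toReal * (l : ℕ))]
  refine measure_mono fun x hx => ?_
  have hl : ((l : ℕ) : ℝ) ≠ 0 := Nat.cast_ne_zero.2 l.ne_zero
  have h : (initialSegment (partialSum x) l).slope = a := hx
  rw [slope_initialSegment] at h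
  rw [Set.mem_ofPred_eq, ← h, EReal.toReal_coe, div_mul_cancel₀ _ hl]

/-- Decompose by the number of faces and solve the recursion at a = ⊤ for the finite measure of
density g. -/
lemma tsum_lintegral_prod_faceSegment [NullSingletonClass μ] (q : ℝ≥0∞) {g : PathSegment → ℝ≥0∞}
    (hg : Measurable g) (hgi : ∫⁻ z, g z ∂(stepSegmentIntensity μ q) ≠ ⊤) :
    ∑' n : ℕ, q ^ n * ∫⁻ x, ∏ i ∈ Finset.range (numFaces (partialSum x) n),
        g (faceSegment (partialSum x) n i) ∂(Measure.infinitePi fun _ : ℕ => μ) =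
      ∑' f : ℕ, (∫⁻ z, g z ∂(stepSegmentIntensity μ q)) ^ f / (f.factorial : ℝ≥0∞) := by
  have hfin : IsFiniteMeasure ((stepSegmentIntensity μ q).withDensity g) :=
    isFiniteMeasure_withDensity hgi
  have h1 : ∀ f, faceGenFun μ q g f ⊤ =
      (∫⁻ z, g z ∂(stepSegmentIntensity μ q)) ^ f / (f.factorial : ℝ≥0∞) := by
    intro f
    rw [iterated_lintegral_eq (ν := (stepSegmentIntensity μ q).withDensity g) measurable_slope
      (fun a => withDensity_absolutelyContinuous _ _ (stepSegmentIntensity_slope_eq μ q a))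
      (faceGenFun_zero μ q g) (faceGenFun_succ μ q hg)]
    simp
  have h2 : ∀ n x, ∏ i ∈ Finset.range (numFaces (partialSum x) n),
      g (faceSegment (partialSum x) n i) = ∑' f, faceWeight g f n x := fun n x => by
    simp only [faceWeight]
    rw [tsum_eq_single (numFaces (partialSum x) n) (fun f hf => if_neg hf.symm), if_pos rfl]
  simp only [← h1, h2, faceGenFun, slopeLESet_top, Set.indicator_univ]
  rw [ENNReal.tsum_comm]
  refine tsum_congr fun n => ?_
  rw [lintegral_tsum fun f => (measurable_faceWeight hg f n).aemeasurable, ENNReal.tsum_mul_left]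

end Intensity

/-! ### Transfer to the given walk and identification of the intensities -/

section Transfer

variable {Ω : Type*} [MeasurableSpace Ω] {P : Measure Ω} {X : ℕ → Ω → ℝ}

lemma map_steps_eq_infinitePi (hX : ∀ i, Measurable (X i)) (hindep : iIndepFun X P)
    (hident : ∀ i, IdentDistrib (X i) (X 0) P P) :
    P.map (fun ω i => X i ω) = Measure.infinitePi fun _ : ℕ => P.map (X 0) := by
  rw [hindep.map_fun_eq_infinitePi_map hX]
  congr 1
  funext i
  exact (hident i).map_eq

lemma measure_eq_of_geometric {q : ℝ} (hq0 : 0 ≤ q) (hq1 : q < 1) {N : Ω → ℕ} (hN : Measurable N)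
    (hgeom : ∀ n : ℕ, P {ω | n ≤ N ω} = ENNReal.ofReal (q ^ n)) (n : ℕ) :
    P {ω | N ω = n} = ENNReal.ofReal (1 - q) * ENNReal.ofReal q ^ n := by
  have h1 : {ω | n ≤ N ω} = {ω | N ω = n} ∪ {ω | n + 1 ≤ N ω} := by
    ext ω
    simp only [Set.mem_ofPred_eq, Set.mem_union]
    omega
  have h2 : P {ω | n ≤ N ω} = P {ω | N ω = n} + P {ω | n + 1 ≤ N ω} := by
    have hm : MeasurableSet {ω | n + 1 ≤ N ω} := hN measurableSet_Ici
    rw [h1, measure_union _ hm]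
    exact Set.disjoint_left.2 fun ω (h : N ω = n) (h' : n + 1 ≤ N ω) => by omega
  rw [hgeom, hgeom] at h2
  rw [ENNReal.eq_sub_of_add_eq ENNReal.ofReal_ne_top h2.symm, ← ENNReal.ofReal_sub _ (by positivity),
    ← ENNReal.ofReal_pow hq0, ← ENNReal.ofReal_mul (by linarith)]
  congr 1
  ring

variable [IsProbabilityMeasure P]

lemma measure_belowChord (hX : ∀ i, Measurable (X i)) (hindep : iIndepFun X P)
    (hident : ∀ i, IdentDistrib (X i) (X 0) P P) (hcont : ∀ x : ℝ, P {ω | X 0 ω = x} = 0)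
    (l : ℕ) (hl : 0 < l) {B : Set ℝ} (hB : MeasurableSet B) :
    (l : ℝ≥0∞) * P (belowChord X l ∩ {ω | walk X ω l ∈ B}) = P {ω | walk X ω l ∈ B} := by
  have hXm : Measurable fun ω i => X i ω := measurable_pi_lambda _ hX
  have hp : IsProbabilityMeasure (P.map (X 0)) :=
    Measure.isProbabilityMeasure_map (hX 0).aemeasurable
  have hn : NullSingletonClass (P.map (X 0)) := ⟨fun x => by
    rw [Measure.map_apply (hX 0) (measurableSet_singleton x)]
    exact hcont x⟩
  have h := cycle_lemma (P.map (X 0)) l hl hB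
  have hBm : MeasurableSet {x : ℕ → ℝ | partialSum x l ∈ B} := measurable_partialSum l hB
  rw [← map_steps_eq_infinitePi hX hindep hident, Measure.map_apply hXm hBm,
    Measure.map_apply hXm ((measurableSet_belowChordSet l).inter hBm)] at h
  exact h

/-- The cycle lemma with B = ℝ gives the conditioning event probability 1/l, so normalising by it
cancels the factor 1/l. -/
lemma segmentIntensity_eq (hX : ∀ i, Measurable (X i)) (hindep : iIndepFun X P)
    (hident : ∀ i, IdentDistrib (X i) (X 0) P P) (hcont : ∀ x : ℝ, P {ω | X 0 ω = x} = 0)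
    {q : ℝ} (hq0 : 0 ≤ q) :
    segmentIntensity P X q = Measure.sum fun l : ℕ+ => ENNReal.ofReal q ^ (l : ℕ) •
      (P.restrict (belowChord X l)).map fun ω => initialSegment (walk X ω) l := by
  unfold segmentIntensity
  congr 1
  funext l
  have hl : (0 : ℝ) < (l : ℕ) := Nat.cast_pos.2 l.pos
  have h1 := measure_belowChord hX hindep hident hcont l l.pos MeasurableSet.univ
  simp only [Set.mem_univ, Set.ofPred_true, Set.inter_univ, measure_univ] at h1
  have h2 : (P (belowChord X l))⁻¹ = ((l : ℕ) : ℝ≥0∞) :=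
    (ENNReal.eq_inv_of_mul_eq_one_left h1).symm
  rw [ProbabilityTheory.cond, h2, Measure.map_smul, smul_smul, ENNReal.ofReal_div_of_pos hl,
    ENNReal.ofReal_natCast, ENNReal.div_mul_cancel (by simp) (by simp), ENNReal.ofReal_pow hq0]

lemma segmentIntensity_eq_stepSegmentIntensity [IsProbabilityMeasure (P.map (X 0))]
    (hX : ∀ i, Measurable (X i)) (hindep : iIndepFun X P)
    (hident : ∀ i, IdentDistrib (X i) (X 0) P P) (hcont : ∀ x : ℝ, P {ω | X 0 ω = x} = 0)
    {q : ℝ} (hq0 : 0 ≤ q) :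
    segmentIntensity P X q = stepSegmentIntensity (P.map (X 0)) (ENNReal.ofReal q) := by
  have hXm : Measurable fun ω i => X i ω := measurable_pi_lambda _ hX
  rw [segmentIntensity_eq hX hindep hident hcont hq0, stepSegmentIntensity,
    ← map_steps_eq_infinitePi hX hindep hident]
  congr 1
  funext l
  rw [Measure.restrict_map hXm (measurableSet_belowChordSet l),
    Measure.map_map (measurable_initialSegment_partialSum l) hXm]
  rfl

/-- Here the cycle lemma is needed for every B: restricting to walks below their chord multiplies
the law of S_l by 1/l. -/
lemma map_segmentIntensity (hX : ∀ i, Measurable (X i)) (hindep : iIndepFun X P)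
    (hident : ∀ i, IdentDistrib (X i) (X 0) P P) (hcont : ∀ x : ℝ, P {ω | X 0 ω = x} = 0)
    {q : ℝ} (hq0 : 0 ≤ q) :
    (segmentIntensity P X q).map (fun z => (z.1, z.last)) = faceIntensity P X q := by
  have hXm : Measurable fun ω i => X i ω := measurable_pi_lambda _ hX
  have hw : ∀ k, Measurable fun ω => walk X ω k := fun k => (measurable_partialSum k).comp hXm
  rw [segmentIntensity_eq hX hindep hident hcont hq0,
    Measure.map_sum measurable_length_last.aemeasurable, faceIntensity]
  congr 1
  funext l
  have hi : Measurable fun ω => initialSegment (walk X ω) l := measurable_initialSegment hw l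
  have hl : (0 : ℝ) < (l : ℕ) := Nat.cast_pos.2 l.pos
  ext B hB
  have hB' : MeasurableSet {y : ℝ | (l, y) ∈ B} := measurable_prodMk_left hB
  rw [Measure.map_smul, Measure.map_map measurable_length_last hi, Measure.smul_apply,
    Measure.smul_apply, Measure.map_apply (measurable_length_last.comp hi) hB,
    Measure.map_apply (measurable_const.prodMk (hw l)) hB,
    Measure.restrict_apply (measurable_length_last.comp hi hB)]
  have h1 : (fun ω => (l, walk X ω l)) ⁻¹' B = {ω | walk X ω l ∈ {y : ℝ | (l, y) ∈ B}} := rfl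
  have h2 : ((fun z : PathSegment => (z.1, z.last)) ∘ fun ω => initialSegment (walk X ω) l) ⁻¹' B ∩
      belowChord X l = belowChord X l ∩ {ω | walk X ω l ∈ {y : ℝ | (l, y) ∈ B}} := by
    rw [Set.inter_comm]
    congr 1
    ext ω
    simp only [Set.mem_preimage, Function.comp_apply, last_initialSegment]
    rfl
  rw [h1, h2, ← measure_belowChord hX hindep hident hcont l l.pos hB', smul_eq_mul, smul_eq_mul,
    ← mul_assoc, ENNReal.ofReal_div_of_pos hl, ENNReal.ofReal_natCast,
    ENNReal.div_mul_cancel (by simp) (by simp), ENNReal.ofReal_pow hq0]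

/-- Integrating a functional of the walk and of an independent geometric time. -/
lemma lintegral_geometric_time (hX : ∀ i, Measurable (X i))
    (hindep : iIndepFun X P) (hident : ∀ i, IdentDistrib (X i) (X 0) P P)
    {q : ℝ} (hq0 : 0 ≤ q) (hq1 : q < 1)
    {N : Ω → ℕ} (hN : Measurable N) (hgeom : ∀ n : ℕ, P {ω | n ≤ N ω} = ENNReal.ofReal (q ^ n))
    (hNX : IndepFun N (fun ω i => X i ω) P) {Φ : ℕ → (ℕ → ℝ) → ℝ≥0∞}
    (hΦ : ∀ n, Measurable (Φ n)) :
    ∫⁻ ω, Φ (N ω) (fun i => X i ω) ∂P = ENNReal.ofReal (1 - q) *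
      ∑' n : ℕ, ENNReal.ofReal q ^ n *
        ∫⁻ x, Φ n x ∂(Measure.infinitePi fun _ : ℕ => P.map (X 0)) := by
  have hXm : Measurable fun ω i => X i ω := measurable_pi_lambda _ hX
  have hp : IsProbabilityMeasure (P.map (X 0)) :=
    Measure.isProbabilityMeasure_map (hX 0).aemeasurable
  have hΦ' : Measurable (Function.uncurry Φ) := measurable_from_prod_countable_right hΦ
  have hmap : P.map (fun ω => (N ω, fun i => X i ω)) =
      (P.map N).prod (Measure.infinitePi fun _ : ℕ => P.map (X 0)) := by
    rw [(indepFun_iff_map_prod_eq_prod_map_map hN.aemeasurable hXm.aemeasurable).1 hNX,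
      map_steps_eq_infinitePi hX hindep hident]
  have hpN : IsProbabilityMeasure (P.map N) := Measure.isProbabilityMeasure_map hN.aemeasurable
  have h1 := lintegral_map hΦ' (hN.prodMk hXm) (μ := P)
  rw [hmap, lintegral_prod _ hΦ'.aemeasurable, lintegral_countable'] at h1
  refine h1.symm.trans ?_
  rw [← ENNReal.tsum_mul_left]
  refine tsum_congr fun n => ?_
  rw [Measure.map_apply hN (measurableSet_singleton n),
    show N ⁻¹' {n} = {ω | N ω = n} from rfl, measure_eq_of_geometric hq0 hq1 hN hgeom, mul_comm,
    mul_assoc]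
  rfl

/-- The path segments below the faces form a Poisson point process. -/
theorem isPoissonPointProcess_segmentProcess (hX : ∀ i, Measurable (X i))
    (hindep : iIndepFun X P) (hident : ∀ i, IdentDistrib (X i) (X 0) P P)
    (hcont : ∀ x : ℝ, P {ω | X 0 ω = x} = 0) {q : ℝ} (hq0 : 0 ≤ q) (hq1 : q < 1)
    {N : Ω → ℕ} (hN : Measurable N) (hgeom : ∀ n : ℕ, P {ω | n ≤ N ω} = ENNReal.ofReal (q ^ n))
    (hNX : IndepFun N (fun ω i => X i ω) P) :
    IsPoissonPointProcess P (fun ω => segmentProcess (walk X ω) (N ω))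
      (segmentIntensity P X q) := by
  have hXm : Measurable fun ω i => X i ω := measurable_pi_lambda _ hX
  have hp : IsProbabilityMeasure (P.map (X 0)) :=
    Measure.isProbabilityMeasure_map (hX 0).aemeasurable
  have hn : NullSingletonClass (P.map (X 0)) := ⟨fun x => by
    rw [Measure.map_apply (hX 0) (measurableSet_singleton x)]
    exact hcont x⟩
  have hfin : IsFiniteMeasure (stepSegmentIntensity (P.map (X 0)) (ENNReal.ofReal q)) :=
    isFiniteMeasure_stepSegmentIntensity _ (by rwa [ENNReal.ofReal_lt_one])
  have hwalk : ∀ ω, walk X ω = partialSum fun i => X i ω := fun _ => rfl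
  rw [segmentIntensity_eq_stepSegmentIntensity hX hindep hident hcont hq0]
  simp only [hwalk, segmentProcess]
  have hm : Measurable fun p : ℕ × (ℕ → ℝ) => segmentProcess (partialSum p.2) p.1 :=
    measurable_from_prod_countable_right measurable_segmentProcess
  refine isPoissonPointProcess_of_lintegral_prod (c := ENNReal.ofReal (1 - q))
    (hm.comp (hN.prodMk hXm)) fun g hg hgi => ?_
  rw [← tsum_lintegral_prod_faceSegment _ _ hg hgi]
  exact lintegral_geometric_time hX hindep hident hq0 hq1 hN hgeom hNX
    (Φ := fun n x => ∏ i ∈ Finset.range (numFaces (partialSum x) n),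
      g (faceSegment (partialSum x) n i)) fun n => measurable_prod_faceSegment n hg

end Transfer

theorem mainTheorem4 {Ω : Type*} [MeasurableSpace Ω] (P : Measure Ω) [IsProbabilityMeasure P]
    (X : ℕ → Ω → ℝ) (hX : ∀ i, Measurable (X i))
    (hindep : iIndepFun X P) (hident : ∀ i, IdentDistrib (X i) (X 0) P P)
    (hcont : ∀ x : ℝ, P {ω | X 0 ω = x} = 0)
    (q : ℝ) (hq0 : 0 ≤ q) (hq1 : q < 1)
    (N : Ω → ℕ) (hN : Measurable N)
    (hgeom : ∀ n : ℕ, P {ω | n ≤ N ω} = ENNReal.ofReal (q ^ n))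
    (hNX : IndepFun N (fun ω i => X i ω) P) :
    IsPoissonPointProcess P (fun ω => faceProcess (walk X ω) (N ω)) (faceIntensity P X q) ∧
    (∀ ω, meetTime (walk X ω) (N ω) 0 = 0 ∧
      meetTime (walk X ω) (N ω) (numFaces (walk X ω) (N ω)) = N ω) ∧
    IsPoissonPointProcess P (fun ω => segmentProcess (walk X ω) (N ω))
      (segmentIntensity P X q) := by
  have h := isPoissonPointProcess_segmentProcess hX hindep hident hcont hq0 hq1 hN hgeom hNX
  refine ⟨?_, fun ω => ⟨meetTime_zero _ _, meetTime_numFaces _ _⟩, h⟩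
  -- Lengths and increments are functions of the segments, so both the process and its intensity are
  -- images under the same map.
  simp only [faceProcess_eq_map]
  rw [← map_segmentIntensity hX hindep hident hcont hq0]
  exact h.map measurable_length_last
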